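/- Let $d\ge 1$, let $0<\lambda_1\le\lambda_2\le\dots\le\lambda_d$ be real numbers, and let $M=\mathbb R\times\mathbb R^d$, with coordinates $(y,x)=(y,x_1,\dots,x_d)$, carry the Riemannian metric $g=dy^2+\sum_{i=1}^d e^{-2\lambda_i y}\,dx_i^2$. Put $$V=\Bigl\{(y,x)\in M:\ \max_{1\le i\le d}e^{-\lambda_i y/2}|x_i|\le 1\Bigr\},\qquad \mathcal H=\partial\bigl(V\cap\{y\le 0\}\bigr),$$ where $\partial$ is the topological boundary in $M$ (the "approximate horosphere"), and $$\mathcal H_0=\Bigl\{y=0,\ \max_{1\le i\le d}e^{-\lambda_i y/2}|x_i|\le 1\Bigr\},\qquad \mathcal H_i^{\pm}=\Bigl\{y\le 0,\ e^{-\lambda_j y/2}|x_j|\le 1\ \text{for all } j\ne i,\ e^{-\lambda_i y/2}x_i=\pm1\Bigr\}\quad(1\le i\le d).$$ 1. The $2d+1$ sets $\mathcal H_0,\mathcal H_1^{\pm},\dots,\mathcal H_d^{\pm}$ (the faces) are pairwise distinct and $\mathcal H=\mathcal H_0\cup\bigcup_{i=1}^d(\mathcal H_i^+\cup\mathcal H_i^-)$.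 Each face is a smooth embedded $d$-dimensional submanifold of $M$ with boundary and corners, and its boundary (corners included) is exactly the set of its points that also lie in another face. 2. For $p,q\in\mathcal H$ let $\operatorname{dist}_{\mathcal H}(p,q)$ be the infimum of the $g$-lengths of the Lipschitz curves contained in $\mathcal H$ that join $p$ to $q$, let $B_{\mathcal H}(p,r)=\{q\in\mathcal H:\operatorname{dist}_{\mathcal H}(p,q)<r\}$, and let $\operatorname{Vol}_{\mathcal H}$ be the sum of the $d$-dimensional Riemannian volumes induced by $g$ on the $2d+1$ faces. Then $\operatorname{dist}_{\mathcal H}$ is finite, and $\mathcal H$ has volume growth of order $r^k$ with $$k=\frac{\lambda_1+\cdots+\lambda_d}{\lambda_1},$$ that is, for every $p\in\mathcal H$ there are $C_p>1$ and $R_p>0$ such that $$C_p^{-1}r^k\le \operatorname{Vol}_{\mathcal H}\bigl(B_{\mathcal H}(p,r)\bigr)\le C_p\,r^k\qquad\text{for all } r>R_p.$$ -/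

import Mathlib

open Set MeasureTheory
open scoped ENNReal ContDiff

noncomputable section

/-- The underlying manifold of `G_A = ℝ ⋉_A ℝ^d` in its global coordinates `(y, x)`. Tangent
vectors at any point are identified with pairs `(v, u)` of the same type. -/
abbrev HeintzePoint (d : ℕ) : Type := ℝ × (Fin d → ℝ)

/-- The Riemannian metric `g = dy² + ∑ i, e^{-2 λ_i y} dx_i²` at the point `p = (y, x)`. -/
def heintzeInner {d : ℕ} (lam : Fin d → ℝ) (p v w : HeintzePoint d) : ℝ :=
  v.1 * w.1 + ∑ i, Real.exp (-2 * lam i * p.1) * (v.2 i * w.2 i)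

/-- The Riemannian norm of the tangent vector `v` at `p`. -/
def heintzeNorm {d : ℕ} (lam : Fin d → ℝ) (p v : HeintzePoint d) : ℝ :=
  Real.sqrt (heintzeInner lam p v v)

/-! ### The approximate horosphere and its faces -/

/-- `V = {(y, x) | max_i e^{-λ_i y / 2} |x_i| ≤ 1}`. -/
def heintzeV {d : ℕ} (lam : Fin d → ℝ) : Set (HeintzePoint d) :=
  {p | ∀ i, Real.exp (-(lam i * p.1 / 2)) * |p.2 i| ≤ 1}

/-- The approximate horosphere: the topological boundary of `V ∩ {y ≤ 0}`. -/
def approxHorosphere {d : ℕ} (lam : Fin d → ℝ) : Set (HeintzePoint d) :=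
  frontier (heintzeV lam ∩ {p | p.1 ≤ 0})

/-- Labels of the faces: `none` for the horizontal face, `some (i, true)` and `some (i, false)` for
the two lateral faces in the direction `x_i`. -/
abbrev FaceIndex (d : ℕ) : Type := Option (Fin d × Bool)

/-- The sign `±1` of a lateral face. -/
def faceSign (s : Bool) : ℝ := if s then 1 else -1

/-- The faces of the approximate horosphere. -/
def horoFace {d : ℕ} (lam : Fin d → ℝ) : FaceIndex d → Set (HeintzePoint d)
  | none => {p | p.1 = 0 ∧ ∀ i, Real.exp (-(lam i * p.1 / 2)) * |p.2 i| ≤ 1}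
  | some (i, s) => {p | p.1 ≤ 0 ∧
      (∀ j, j ≠ i → Real.exp (-(lam j * p.1 / 2)) * |p.2 j| ≤ 1) ∧
      Real.exp (-(lam i * p.1 / 2)) * p.2 i = faceSign s}

/-! ### Smooth hypersurfaces with boundary and corners -/

/-- `F` looks near `p ∈ F`, in a smooth chart `ψ` of the ambient manifold centred at `p`, like
`{(t, z) | t = 0 and z_j ≥ 0 for j ∈ J}` near the origin of `ℝ × ℝ^d`. -/
def HasCornerChart {d : ℕ} (F : Set (HeintzePoint d)) (p : HeintzePoint d)
    (J : Finset (Fin d)) : Prop :=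
  ∃ ψ : OpenPartialHomeomorph (HeintzePoint d) (HeintzePoint d),
    p ∈ ψ.source ∧ ψ p = 0 ∧
    ContDiffOn ℝ ∞ ψ ψ.source ∧ ContDiffOn ℝ ∞ ψ.symm ψ.target ∧
    ∀ q ∈ ψ.source, q ∈ F ↔ ((ψ q).1 = 0 ∧ ∀ j ∈ J, 0 ≤ (ψ q).2 j)

/-- `F` is a smooth embedded hypersurface (of dimension `d`) with boundary and corners. -/
def IsSmoothHypersurfaceWithCorners {d : ℕ} (F : Set (HeintzePoint d)) : Prop :=
  ∀ p ∈ F, ∃ J : Finset (Fin d), HasCornerChart F p J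

/-- The boundary, corners included, of a hypersurface with corners: the points around which the
local model is not the full hyperplane. -/
def cornerBoundary {d : ℕ} (F : Set (HeintzePoint d)) : Set (HeintzePoint d) :=
  {p | p ∈ F ∧ ∃ J : Finset (Fin d), J.Nonempty ∧ HasCornerChart F p J}

/-! ### The induced length structure -/

/-- `γ`, restricted to `[0, 1]`, is a Lipschitz curve in `X` from `p` to `q`. (On compact sets the
coordinate distance and the Riemannian distance are bi-Lipschitz equivalent, so the class of
Lipschitz curves is the same for both.) -/
def IsLipschitzCurveIn {d : ℕ} (X : Set (HeintzePoint d)) (p q : HeintzePoint d)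
    (γ : ℝ → HeintzePoint d) : Prop :=
  (∃ K, LipschitzOnWith K γ (Icc 0 1)) ∧ (∀ t ∈ Icc (0 : ℝ) 1, γ t ∈ X) ∧ γ 0 = p ∧ γ 1 = q

/-- The Riemannian length of a Lipschitz curve `γ : [0, 1] → M`, which is differentiable almost
everywhere. -/
def curveLength {d : ℕ} (lam : Fin d → ℝ) (γ : ℝ → HeintzePoint d) : ℝ≥0∞ :=
  ∫⁻ t in Ioo (0 : ℝ) 1, ENNReal.ofReal (heintzeNorm lam (γ t) (deriv γ t))

/-- The intrinsic distance of `X`: the infimum of the lengths of the curves contained in `X`. -/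
def inducedDist {d : ℕ} (lam : Fin d → ℝ) (X : Set (HeintzePoint d)) (p q : HeintzePoint d) :
    ℝ≥0∞ :=
  ⨅ (γ : ℝ → HeintzePoint d) (_ : IsLipschitzCurveIn X p q γ), curveLength lam γ

/-- The open ball of `X` for its intrinsic distance. -/
def inducedBall {d : ℕ} (lam : Fin d → ℝ) (X : Set (HeintzePoint d)) (p : HeintzePoint d)
    (r : ℝ) : Set (HeintzePoint d) :=
  {q | q ∈ X ∧ inducedDist lam X p q < ENNReal.ofReal r}

/-! ### The induced volume -/

/-- The Gram matrix of the pulled back metric `φ^* g` at `u`, for a parametrization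
`φ : ℝ^d → M`. -/
def pullbackGram {d : ℕ} (lam : Fin d → ℝ) (φ : (Fin d → ℝ) → HeintzePoint d) (u : Fin d → ℝ) :
    Matrix (Fin d) (Fin d) ℝ :=
  Matrix.of fun a b =>
    heintzeInner lam (φ u) (fderiv ℝ φ u (Pi.single a 1)) (fderiv ℝ φ u (Pi.single b 1))

/-- The Riemannian volume measure of the piece `F` of the hypersurface injectively parametrized by
`φ`: the image under `φ` of the measure `√(det φ^* g) du` on `φ⁻¹(F)`. -/
def paramVolume {d : ℕ} (lam : Fin d → ℝ) (φ : (Fin d → ℝ) → HeintzePoint d)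
    (F : Set (HeintzePoint d)) : Measure (HeintzePoint d) :=
  (((volume : Measure (Fin d → ℝ)).restrict (φ ⁻¹' F)).withDensity
    fun u => ENNReal.ofReal (Real.sqrt (pullbackGram lam φ u).det)).map φ

/-- The smooth hypersurfaces carrying the faces, as graphs over coordinate hyperplanes: `{y = 0}`
for the horizontal face, and `{x_i = ± e^{λ_i y / 2}}` for the lateral ones, where the `i`-th
parameter is `y` and the other parameters are the `x_j`, `j ≠ i`. -/
def faceParam {d : ℕ} (lam : Fin d → ℝ) : FaceIndex d → (Fin d → ℝ) → HeintzePoint d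
  | none => fun u => (0, u)
  | some (i, s) => fun u =>
      (u i, Function.update u i (faceSign s * Real.exp (lam i * u i / 2)))

/-- The induced volume of the approximate horosphere: the sum of the Riemannian volumes of its
faces. -/
def horosphereVolume {d : ℕ} (lam : Fin d → ℝ) : Measure (HeintzePoint d) :=
  ∑ a : FaceIndex d, paramVolume lam (faceParam lam a) (horoFace lam a)

/-- `X`, with its intrinsic distance and the measure `vol`, has volume growth of order `r ^ k`. -/
def HasVolumeGrowthOfOrder {d : ℕ} (lam : Fin d → ℝ) (X : Set (HeintzePoint d))
    (vol : Measure (HeintzePoint d)) (k : ℝ) : Prop :=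
  ∀ p ∈ X, ∃ C : ℝ, 1 < C ∧ ∃ R : ℝ, 0 < R ∧ ∀ r : ℝ, R < r →
    ENNReal.ofReal (C⁻¹ * r ^ k) ≤ vol (inducedBall lam X p r) ∧
    vol (inducedBall lam X p r) ≤ ENNReal.ofReal (C * r ^ k)

end

theorem exp_neg_mul_le_one_iff (a x : ℝ) :
    Real.exp (-a) * x ≤ 1 ↔ x ≤ Real.exp a := by
  rw [Real.exp_neg, inv_mul_le_iff₀ (Real.exp_pos a), mul_one]

theorem exp_neg_mul_eq_iff (a x c : ℝ) :
    Real.exp (-a) * x = c ↔ x = c * Real.exp a := by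
  rw [Real.exp_neg, inv_mul_eq_iff_eq_mul₀ (Real.exp_pos a).ne', mul_comm]

theorem mem_heintzeV_iff {d : ℕ} {lam : Fin d → ℝ} {p : HeintzePoint d} :
    p ∈ heintzeV lam ↔ ∀ i, |p.2 i| ≤ Real.exp (lam i * p.1 / 2) := by
  simp only [heintzeV, mem_ofPred_eq, exp_neg_mul_le_one_iff]

theorem mem_horoFace_none_iff {d : ℕ} {lam : Fin d → ℝ} {p : HeintzePoint d} :
    p ∈ horoFace lam none ↔ p.1 = 0 ∧ ∀ i, |p.2 i| ≤ 1 := by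
  simp only [horoFace, mem_ofPred_eq, exp_neg_mul_le_one_iff]
  refine and_congr_right fun h => ?_
  simp [h]

theorem mem_horoFace_some_iff {d : ℕ} {lam : Fin d → ℝ} {i : Fin d} {s : Bool}
    {p : HeintzePoint d} :
    p ∈ horoFace lam (some (i, s)) ↔ p.1 ≤ 0 ∧
      (∀ j, j ≠ i → |p.2 j| ≤ Real.exp (lam j * p.1 / 2)) ∧
      p.2 i = faceSign s * Real.exp (lam i * p.1 / 2) := by
  simp only [horoFace, mem_ofPred_eq, exp_neg_mul_le_one_iff, exp_neg_mul_eq_iff]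

theorem abs_faceSign (s : Bool) : |faceSign s| = 1 := by
  cases s <;> simp [faceSign]

theorem faceSign_mul_self (s : Bool) : faceSign s * faceSign s = 1 := by
  cases s <;> simp [faceSign]

theorem faceSign_injective : Function.Injective faceSign := by
  intro s t h
  cases s <;> cases t <;> simp [faceSign] at h ⊢ <;> norm_num at h

theorem abs_eq_iff_exists_faceSign {x e : ℝ} (he : 0 ≤ e) :
    |x| = e ↔ ∃ s, x = faceSign s * e := by
  constructor
  · intro h
    rcases abs_choice x with h' | h'
    · exact ⟨true, by simp [faceSign]; linarith⟩
    · exact ⟨false, by simp [faceSign]; linarith⟩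
  · rintro ⟨s, rfl⟩
    rw [abs_mul, abs_faceSign, one_mul, abs_of_nonneg he]

theorem abs_apply_le_of_mem_horoFace {d : ℕ} {lam : Fin d → ℝ} {a : FaceIndex d}
    {p : HeintzePoint d} (hp : p ∈ horoFace lam a) (j : Fin d) :
    |p.2 j| ≤ Real.exp (lam j * p.1 / 2) := by
  rcases a with _ | ⟨i, s⟩
  · rw [mem_horoFace_none_iff] at hp
    simpa [hp.1] using hp.2 j
  · rw [mem_horoFace_some_iff] at hp
    by_cases h : j = i
    · subst h
      rw [hp.2.2, abs_mul, abs_faceSign, one_mul, abs_of_pos (Real.exp_pos _)]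
    · exact hp.2.1 j h

theorem fst_nonpos_of_mem_horoFace {d : ℕ} {lam : Fin d → ℝ} {a : FaceIndex d}
    {p : HeintzePoint d} (hp : p ∈ horoFace lam a) : p.1 ≤ 0 := by
  rcases a with _ | ⟨i, s⟩
  · exact hp.1.le
  · exact hp.1

/-! ### The frontier is the union of the faces -/

theorem isClosed_heintzeV_inter {d : ℕ} (lam : Fin d → ℝ) :
    IsClosed (heintzeV lam ∩ {p : HeintzePoint d | p.1 ≤ 0}) := by
  refine IsClosed.inter ?_ (isClosed_le continuous_fst continuous_const)
  rw [heintzeV, ofPred_forall]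
  exact isClosed_iInter fun i => isClosed_le (by fun_prop) continuous_const

theorem interior_heintzeV_inter {d : ℕ} (lam : Fin d → ℝ) :
    interior (heintzeV lam ∩ {p : HeintzePoint d | p.1 ≤ 0}) =
      {p | p.1 < 0 ∧ ∀ i, |p.2 i| < Real.exp (lam i * p.1 / 2)} := by
  apply Subset.antisymm
  · intro p hp
    rw [mem_interior_iff_mem_nhds] at hp
    have key : ∀ c : ℝ → HeintzePoint d, Continuous c → c 0 = p →
        ∃ ε : ℝ, 0 < ε ∧ c ε ∈ heintzeV lam ∩ {p : HeintzePoint d | p.1 ≤ 0} := by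
      intro c hc h0
      have h1 : ∀ᶠ ε in nhds (0 : ℝ), c ε ∈ heintzeV lam ∩ {p : HeintzePoint d | p.1 ≤ 0} :=
        hc.continuousAt.eventually_mem (by rwa [h0])
      have h2 : ∀ᶠ ε in nhdsWithin (0 : ℝ) (Ioi 0),
          c ε ∈ heintzeV lam ∩ {p : HeintzePoint d | p.1 ≤ 0} := h1.filter_mono nhdsWithin_le_nhds
      obtain ⟨ε, hε⟩ := (h2.and self_mem_nhdsWithin).exists
      exact ⟨ε, hε.2, hε.1⟩
    have hp' := mem_of_mem_nhds hp
    have hle := mem_heintzeV_iff.1 hp'.1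
    refine ⟨lt_of_le_of_ne hp'.2 fun h => ?_, fun i => lt_of_le_of_ne (hle i) fun h => ?_⟩
    -- Dilating `x` at fixed height leaves `V` at once if `|x_i|` equals its positive bound.
    · obtain ⟨ε, hε, -, h1⟩ := key (fun ε => (p.1 + ε, p.2)) (by fun_prop) (by simp)
      simp only [mem_ofPred_eq] at h1
      linarith
    · obtain ⟨ε, hε, h1, -⟩ := key (fun ε => (p.1, (1 + ε) • p.2)) (by fun_prop) (by simp)
      have h2 := mem_heintzeV_iff.1 h1 i
      simp only [Pi.smul_apply, smul_eq_mul, abs_mul] at h2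
      rw [abs_of_pos (by linarith : (0 : ℝ) < 1 + ε), h] at h2
      nlinarith [Real.exp_pos (lam i * p.1 / 2)]
  · refine interior_maximal ?_ ?_
    · rintro p ⟨h, h'⟩
      exact ⟨mem_heintzeV_iff.2 fun i => (h' i).le, h.le⟩
    · rw [ofPred_and, ofPred_forall]
      refine (isOpen_lt continuous_fst continuous_const).inter (isOpen_iInter_of_finite fun i => ?_)
      exact isOpen_lt (by fun_prop) (by fun_prop)

theorem approxHorosphere_eq_iUnion {d : ℕ} (lam : Fin d → ℝ) :
    approxHorosphere lam = ⋃ a : FaceIndex d, horoFace lam a := by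
  rw [approxHorosphere, (isClosed_heintzeV_inter lam).frontier_eq, interior_heintzeV_inter]
  ext p
  simp only [mem_sdiff, mem_inter_iff, mem_heintzeV_iff, mem_ofPred_eq, mem_iUnion, not_and,
    not_forall, not_lt]
  constructor
  · rintro ⟨⟨h1, h2⟩, h3⟩
    rcases h2.lt_or_eq with h | h
    · obtain ⟨i, hi⟩ := h3 h
      obtain ⟨s, hs⟩ := (abs_eq_iff_exists_faceSign (Real.exp_pos _).le).1 (le_antisymm (h1 i) hi)
      exact ⟨some (i, s), mem_horoFace_some_iff.2 ⟨h2, fun j _ => h1 j, hs⟩⟩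
    · refine ⟨none, mem_horoFace_none_iff.2 ⟨h, fun i => ?_⟩⟩
      simpa [h] using h1 i
  · rintro ⟨a, ha⟩
    refine ⟨⟨abs_apply_le_of_mem_horoFace ha, fst_nonpos_of_mem_horoFace ha⟩, fun h => ?_⟩
    rcases a with _ | ⟨i, s⟩
    · exact absurd ha.1 h.ne
    · refine ⟨i, ?_⟩
      rw [(mem_horoFace_some_iff.1 ha).2.2, abs_mul, abs_faceSign, one_mul,
        abs_of_pos (Real.exp_pos _)]

/-! ### The faces are distinct -/

theorem horoFace_injective {d : ℕ} (lam : Fin d → ℝ) :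
    Function.Injective (horoFace lam) := by
  -- A witness on exactly one face: height `-1` excludes the horizontal face, and vanishing of the
  -- other coordinates excludes the other lateral faces.
  let c : Fin d × Bool → HeintzePoint d := fun b =>
    (-1, Pi.single b.1 (faceSign b.2 * Real.exp (lam b.1 * (-1) / 2)))
  have hc : ∀ b, c b ∈ horoFace lam (some b) := by
    rintro ⟨i, s⟩
    refine mem_horoFace_some_iff.2 ⟨by simp [c], fun j hj => ?_, by simp [c]⟩
    simp [c, hj, Real.exp_nonneg]
  have hn : ∀ b, c b ∉ horoFace lam none := by
    intro b hb
    have := (mem_horoFace_none_iff.1 hb).1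
    norm_num [c] at this
  have hu : ∀ b b', c b ∈ horoFace lam (some b') → b' = b := by
    rintro ⟨i, s⟩ ⟨j, t⟩ h
    have h1 := (mem_horoFace_some_iff.1 h).2.2
    by_cases hij : j = i
    · subst hij
      simp only [c, Pi.single_eq_same] at h1
      rw [faceSign_injective (mul_right_cancel₀ (Real.exp_pos _).ne' h1)]
    · simp only [c, Pi.single_eq_of_ne hij] at h1
      have h2 := congrArg abs h1
      rw [abs_mul, abs_faceSign, one_mul, abs_zero] at h2
      exact absurd (abs_eq_zero.1 h2.symm) (Real.exp_pos _).ne'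
  rintro (_ | a) (_ | b) h
  · rfl
  · exact absurd (h ▸ hc b) (hn b)
  · exact absurd (h ▸ hc a) (hn a)
  · rw [hu b a (h ▸ hc b)]

theorem ncard_range_horoFace {d : ℕ} (lam : Fin d → ℝ) :
    (Set.range (horoFace lam)).ncard = 2 * d + 1 := by
  rw [← image_univ, ncard_image_of_injective _ (horoFace_injective lam), ncard_univ,
    Nat.card_eq_fintype_card]
  simp [FaceIndex, mul_comm]

/-! ### Corner charts -/

theorem HasCornerChart.of_contDiff {d : ℕ} {F : Set (HeintzePoint d)} {p : HeintzePoint d}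
    {J : Finset (Fin d)} {f g : HeintzePoint d → HeintzePoint d} (hf : ContDiff ℝ ∞ f)
    (hg : ContDiff ℝ ∞ g) (hgf : Function.LeftInverse g f) (hfg : Function.RightInverse g f)
    (hp : f p = 0) {U : Set (HeintzePoint d)} (hU : IsOpen U) (hpU : p ∈ U)
    (hF : ∀ q ∈ U, q ∈ F ↔ ((f q).1 = 0 ∧ ∀ j ∈ J, 0 ≤ (f q).2 j)) :
    HasCornerChart F p J := by
  let e : HeintzePoint d ≃ₜ HeintzePoint d := ⟨⟨f, g, hgf, hfg⟩, hf.continuous, hg.continuous⟩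
  refine ⟨e.toOpenPartialHomeomorph.restrOpen U hU, by simpa using hpU, hp, ?_, ?_, ?_⟩
  · exact hf.contDiffOn
  · exact hg.contDiffOn
  · intro q hq
    exact hF q (by simpa using hq)

open Classical in
/-- The directions in which the face `a` has a boundary at `p`. -/
noncomputable def faceCornerSet {d : ℕ} (lam : Fin d → ℝ) (a : FaceIndex d) (p : HeintzePoint d) :
    Finset (Fin d) :=
  match a with
  | none => Finset.univ.filter fun j => |p.2 j| = 1
  | some (i, _) => Finset.univ.filter fun j =>
      if j = i then p.1 = 0 else |p.2 j| = Real.exp (lam j * p.1 / 2)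

theorem exists_sign_mul_eq_abs (x : ℝ) : ∃ c : ℝ, c * c = 1 ∧ c * x = |x| := by
  rcases abs_choice x with h | h
  · exact ⟨1, by norm_num, by rw [h, one_mul]⟩
  · exact ⟨-1, by norm_num, by rw [h, neg_one_mul]⟩

theorem abs_eq_mul_of_mul_self_eq_one {c x : ℝ} (hc : c * c = 1) (h : 0 ≤ c * x) :
    |x| = c * x := by
  rcases mul_self_eq_one_iff.1 hc with rfl | rfl
  · rw [one_mul] at *; exact abs_of_nonneg h
  · rw [neg_one_mul] at *; exact abs_of_nonpos (by linarith)

theorem hasCornerChart_horoFace_none {d : ℕ} (lam : Fin d → ℝ) {p : HeintzePoint d}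
    (hp : p ∈ horoFace lam none) :
    HasCornerChart (horoFace lam none) p (faceCornerSet lam none p) := by
  rw [mem_horoFace_none_iff] at hp
  choose c hc hcp using fun j => exists_sign_mul_eq_abs (p.2 j)
  -- On `U` the inactive constraints hold automatically, and each active coordinate keeps its sign,
  -- so that `|x_j|` is the linear function `c j * x_j`.
  let U : Set (HeintzePoint d) := {q | ∀ j, if |p.2 j| = 1 then 0 < c j * q.2 j else |q.2 j| < 1}
  refine HasCornerChart.of_contDiff (U := U)
    (f := fun q => (q.1, fun j => |p.2 j| - c j * q.2 j))
    (g := fun q => (q.1, fun j => c j * (|p.2 j| - q.2 j))) (by fun_prop) (by fun_prop)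
    ?_ ?_ ?_ ?_ ?_ ?_
  · intro q
    ext j
    · rfl
    · linear_combination q.2 j * hc j
  · intro q
    ext j
    · rfl
    · simp only
      linear_combination (q.2 j - |p.2 j|) * hc j
  · ext j
    · exact hp.1
    · simp [hcp]
  · simp only [U, ofPred_forall]
    refine isOpen_iInter_of_finite fun j => ?_
    split_ifs
    · exact isOpen_lt continuous_const (by fun_prop)
    · exact isOpen_lt (by fun_prop) continuous_const
  · intro j
    split_ifs with h
    · rw [hcp, h]; exact one_pos
    · exact lt_of_le_of_ne (hp.2 j) h
  · intro q hq
    rw [mem_horoFace_none_iff]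
    refine and_congr_right fun _ => ?_
    simp only [faceCornerSet, Finset.mem_filter, Finset.mem_univ, true_and]
    refine forall_congr' fun j => ?_
    have hj := hq j
    split_ifs at hj with h
    · simp only [h, forall_const, abs_eq_mul_of_mul_self_eq_one (hc j) hj.le, sub_nonneg]
    · simp [h, hj.le]

/-- The defining equation for `x_i` becomes the first chart coordinate. This frees slot `i`, which
records the constraint `y ≤ 0`; each other slot records the slack of its own constraint. -/
theorem hasCornerChart_horoFace_some {d : ℕ} (lam : Fin d → ℝ) {i : Fin d} {s : Bool}
    {p : HeintzePoint d} (hp : p ∈ horoFace lam (some (i, s))) :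
    HasCornerChart (horoFace lam (some (i, s))) p (faceCornerSet lam (some (i, s)) p) := by
  have hp' := hp
  rw [mem_horoFace_some_iff] at hp
  choose c hc hcp using fun j => exists_sign_mul_eq_abs (p.2 j)
  -- The shift centres the chart at `p` even in inactive directions; in active ones it vanishes,
  -- leaving the true bound `e^{λ_j y/2}`.
  let e : Fin d → ℝ → ℝ := fun j y => |p.2 j| - Real.exp (lam j * p.1 / 2) + Real.exp (lam j * y / 2)
  let U : Set (HeintzePoint d) := {q | (p.1 < 0 → q.1 < 0) ∧ ∀ j,
    if |p.2 j| = Real.exp (lam j * p.1 / 2) then 0 < c j * q.2 j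
    else |q.2 j| < Real.exp (lam j * q.1 / 2)}
  refine HasCornerChart.of_contDiff (U := U)
    (f := fun q => (q.2 i - faceSign s * Real.exp (lam i * q.1 / 2),
      fun j => if j = i then p.1 - q.1 else e j q.1 - c j * q.2 j))
    (g := fun q => (p.1 - q.2 i, fun j => if j = i then
        q.1 + faceSign s * Real.exp (lam i * (p.1 - q.2 i) / 2) else
        c j * (e j (p.1 - q.2 i) - q.2 j))) ?_ ?_
    ?_ ?_ ?_ ?_ ?_ ?_
  · refine ContDiff.prodMk (by fun_prop) (contDiff_pi.2 fun j => ?_)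
    split_ifs <;> fun_prop
  · refine ContDiff.prodMk (by fun_prop) (contDiff_pi.2 fun j => ?_)
    split_ifs <;> fun_prop
  · intro q
    ext j
    · simp
    · by_cases h : j = i
      · subst h; simp
      · simp only [h, if_false, if_true, sub_sub_cancel]
        linear_combination q.2 j * hc j
  · intro q
    ext j
    · simp
    · by_cases h : j = i
      · subst h; simp
      · simp only [h, if_false]
        linear_combination (q.2 j - e j (p.1 - q.2 i)) * hc j
  · ext j
    · simp [hp.2.2]
    · by_cases h : j = i <;> simp [h, e, hcp]
  · simp only [U, ofPred_forall, ofPred_and]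
    refine IsOpen.inter (isOpen_iInter_of_finite fun _ =>
      isOpen_lt continuous_fst continuous_const) (isOpen_iInter_of_finite fun j => ?_)
    split_ifs
    · exact isOpen_lt continuous_const (by fun_prop)
    · exact isOpen_lt (by fun_prop) (by fun_prop)
  · refine ⟨id, fun j => ?_⟩
    split_ifs with h
    · rw [hcp, h]; exact Real.exp_pos _
    · exact lt_of_le_of_ne (abs_apply_le_of_mem_horoFace hp' j) h
  · rintro q ⟨hq1, hq⟩
    rw [mem_horoFace_some_iff, ← and_assoc, and_comm]
    refine and_congr sub_eq_zero.symm ?_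
    simp only [faceCornerSet, Finset.mem_filter, Finset.mem_univ, true_and]
    have key : ∀ j, j ≠ i → (|q.2 j| ≤ Real.exp (lam j * q.1 / 2) ↔
        (|p.2 j| = Real.exp (lam j * p.1 / 2) → 0 ≤ e j q.1 - c j * q.2 j)) := by
      intro j _
      have hj := hq j
      split_ifs at hj with h
      · simp only [h, forall_const, abs_eq_mul_of_mul_self_eq_one (hc j) hj.le, sub_nonneg, e,
          sub_self, zero_add]
      · simp [h, hj.le]
    constructor
    · rintro ⟨h1, h2⟩ j hj
      by_cases h : j = i
      · simp only [h, if_true] at hj ⊢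
        linarith
      · simp only [h, if_false] at hj ⊢
        exact (key j h).1 (h2 j h) hj
    · intro h
      refine ⟨?_, fun j hj => (key j hj).2 fun h' => ?_⟩
      · rcases hp.1.lt_or_eq with h0 | h0
        · exact (hq1 h0).le
        · have := h i (by simp [h0])
          simp only [if_true] at this
          linarith
      · have := h j (by simpa [hj] using h')
        simpa [hj] using this

theorem hasCornerChart_horoFace {d : ℕ} (lam : Fin d → ℝ) (a : FaceIndex d) {p : HeintzePoint d}
    (hp : p ∈ horoFace lam a) : HasCornerChart (horoFace lam a) p (faceCornerSet lam a p) := by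
  rcases a with _ | ⟨i, s⟩
  · exact hasCornerChart_horoFace_none lam hp
  · exact hasCornerChart_horoFace_some lam hp

theorem faceCornerSet_nonempty_iff {d : ℕ} (lam : Fin d → ℝ) (a : FaceIndex d)
    {p : HeintzePoint d} (hp : p ∈ horoFace lam a) :
    (faceCornerSet lam a p).Nonempty ↔ ∃ b, b ≠ a ∧ p ∈ horoFace lam b := by
  have hle := abs_apply_le_of_mem_horoFace hp
  have hy := fst_nonpos_of_mem_horoFace hp
  have hmem : ∀ j t, p.2 j = faceSign t * Real.exp (lam j * p.1 / 2) →
      p ∈ horoFace lam (some (j, t)) := fun j t h =>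
    mem_horoFace_some_iff.2 ⟨hy, fun k _ => hle k, h⟩
  have habs : ∀ j t, p ∈ horoFace lam (some (j, t)) →
      |p.2 j| = Real.exp (lam j * p.1 / 2) := fun j t h =>
    (abs_eq_iff_exists_faceSign (Real.exp_pos _).le).2 ⟨t, (mem_horoFace_some_iff.1 h).2.2⟩
  rcases a with _ | ⟨i, s⟩
  · have h0 := (mem_horoFace_none_iff.1 hp).1
    simp only [faceCornerSet, Finset.Nonempty, Finset.mem_filter, Finset.mem_univ, true_and]
    constructor
    · rintro ⟨j, hj⟩
      obtain ⟨t, ht⟩ := (abs_eq_iff_exists_faceSign zero_le_one).1 hj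
      exact ⟨some (j, t), by simp, hmem j t (by simpa [h0] using ht)⟩
    · rintro ⟨_ | ⟨j, t⟩, hb, hpb⟩
      · exact absurd rfl hb
      · exact ⟨j, by simpa [h0] using habs j t hpb⟩
  · simp only [faceCornerSet, Finset.Nonempty, Finset.mem_filter, Finset.mem_univ, true_and]
    constructor
    · rintro ⟨j, hj⟩
      split_ifs at hj with h
      · refine ⟨none, by simp, mem_horoFace_none_iff.2 ⟨hj, fun k => ?_⟩⟩
        simpa [hj] using hle k
      · obtain ⟨t, ht⟩ := (abs_eq_iff_exists_faceSign (Real.exp_pos _).le).1 hj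
        exact ⟨some (j, t), by simp [h], hmem j t ht⟩
    · rintro ⟨_ | ⟨j, t⟩, hb, hpb⟩
      · exact ⟨i, by simpa using (mem_horoFace_none_iff.1 hpb).1⟩
      · refine ⟨j, ?_⟩
        have hji : j ≠ i := by
          rintro rfl
          have h1 := (mem_horoFace_some_iff.1 hpb).2.2
          rw [(mem_horoFace_some_iff.1 hp).2.2] at h1
          rw [faceSign_injective (mul_right_cancel₀ (Real.exp_pos _).ne' h1)] at hb
          exact hb rfl
        simpa [hji] using habs j t hpb

/-- A point with an interior chart has no boundary chart. -/
theorem HasCornerChart.eq_empty {d : ℕ} {F : Set (HeintzePoint d)} {p : HeintzePoint d}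
    {J : Finset (Fin d)} (h₁ : HasCornerChart F p ∅) (h₂ : HasCornerChart F p J) : J = ∅ := by
  by_contra hJ
  obtain ⟨j, hj⟩ := Finset.nonempty_iff_ne_empty.2 hJ
  obtain ⟨φ, hφp, hφ0, hφ, hφs, hφF⟩ := h₁
  obtain ⟨ψ, hψp, hψ0, hψ, hψs, hψF⟩ := h₂
  have h0 : (0 : HeintzePoint d) ∈ φ.target := hφ0 ▸ φ.map_source hφp
  have h0' : (0 : HeintzePoint d) ∈ ψ.target := hψ0 ▸ ψ.map_source hψp
  have hφs0 : φ.symm 0 = p := by rw [← hφ0, φ.left_inv hφp]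
  have hψs0 : ψ.symm 0 = p := by rw [← hψ0, ψ.left_inv hψp]
  have dφ : DifferentiableAt ℝ φ p :=
    (hφ.contDiffAt (φ.open_source.mem_nhds hφp)).differentiableAt (by simp)
  have dψ : DifferentiableAt ℝ ψ p :=
    (hψ.contDiffAt (ψ.open_source.mem_nhds hψp)).differentiableAt (by simp)
  have dφs : DifferentiableAt ℝ φ.symm 0 :=
    (hφs.contDiffAt (φ.open_target.mem_nhds h0)).differentiableAt (by simp)
  have dψs : DifferentiableAt ℝ ψ.symm 0 :=
    (hψs.contDiffAt (ψ.open_target.mem_nhds h0')).differentiableAt (by simp)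
  set A := fderiv ℝ φ.symm 0
  set B := fderiv ℝ ψ p
  have hA : HasFDerivAt φ.symm A 0 := dφs.hasFDerivAt
  have hB : HasFDerivAt ψ B (φ.symm 0) := by rw [hφs0]; exact dψ.hasFDerivAt
  have hinjA : Function.Injective A := by
    have h1 : HasFDerivAt (φ ∘ φ.symm) ((fderiv ℝ φ p).comp A) 0 :=
      HasFDerivAt.comp 0 (by rw [hφs0]; exact dφ.hasFDerivAt) hA
    have h2 : HasFDerivAt (φ ∘ φ.symm) (ContinuousLinearMap.id ℝ _) 0 :=
      (hasFDerivAt_id _).congr_of_eventuallyEq (φ.eventually_right_inverse h0)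
    have h3 := h1.unique h2
    exact Function.LeftInverse.injective (g := fderiv ℝ φ p) fun v => DFunLike.congr_fun h3 v
  have hinjB : Function.Injective B := by
    have h1 : HasFDerivAt (ψ.symm ∘ ψ) ((fderiv ℝ ψ.symm 0).comp B) p :=
      HasFDerivAt.comp p (by rw [hψ0]; exact dψs.hasFDerivAt) dψ.hasFDerivAt
    have h2 : HasFDerivAt (ψ.symm ∘ ψ) (ContinuousLinearMap.id ℝ _) p :=
      (hasFDerivAt_id _).congr_of_eventuallyEq (ψ.eventually_left_inverse hψp)
    have h3 := h1.unique h2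
    exact Function.LeftInverse.injective (g := fderiv ℝ ψ.symm 0) fun v => DFunLike.congr_fun h3 v
  -- Near the origin, a line in the hyperplane of `φ` stays in `F`, so in the chart `ψ` its `j`-th
  -- coordinate is nonnegative and zero at time 0. This is a local minimum, so the derivative
  -- vanishes.
  have key : ∀ v : Fin d → ℝ, (B (A (0, v))).1 = 0 ∧ (B (A (0, v))).2 j = 0 := by
    intro v
    let l : ℝ → HeintzePoint d := fun t => t • (0, v)
    have hl : HasDerivAt l (0, v) 0 := by
      simpa only [id, one_smul] using
        (hasDerivAt_id (0 : ℝ)).smul_const ((0, v) : HeintzePoint d)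
    have hl0 : l 0 = 0 := by simp [l]
    let c : ℝ → HeintzePoint d := fun t => ψ (φ.symm (l t))
    have hc : HasDerivAt c (B (A (0, v))) 0 := by
      have h1 : HasFDerivAt (fun z => ψ (φ.symm z)) (B.comp A) (l 0) := by
        rw [hl0]; exact HasFDerivAt.comp 0 hB hA
      exact h1.comp_hasDerivAt 0 hl
    have hc0 : c 0 = 0 := by simp [c, hl0, hφs0, hψ0]
    have hev : ∀ᶠ t in nhds (0 : ℝ), (c t).1 = 0 ∧ 0 ≤ (c t).2 j := by
      have e1 : ∀ᶠ t in nhds (0 : ℝ), l t ∈ φ.target :=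
        hl.continuousAt.eventually_mem (by rw [hl0]; exact φ.open_target.mem_nhds h0)
      have e2 : ∀ᶠ t in nhds (0 : ℝ), φ.symm (l t) ∈ ψ.source := by
        have hcont : ContinuousAt (fun t => φ.symm (l t)) 0 :=
          ContinuousAt.comp (by rw [hl0]; exact hA.continuousAt) hl.continuousAt
        exact hcont.eventually_mem (by
          simp only [hl0, hφs0]; exact ψ.open_source.mem_nhds hψp)
      filter_upwards [e1, e2] with t ht1 ht2
      have hF : φ.symm (l t) ∈ F := by
        rw [hφF _ (φ.map_target ht1), φ.right_inv ht1]
        simp [l]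
      have := (hψF _ ht2).1 hF
      exact ⟨this.1, this.2 j hj⟩
    have hc1 : HasDerivAt (fun t => (c t).1) (B (A (0, v))).1 0 := hc.fst
    have hc2 : HasDerivAt (fun t => (c t).2 j) ((B (A (0, v))).2 j) 0 :=
      hasDerivAt_pi.1 hc.snd j
    constructor
    · exact hc1.unique ((hasDerivAt_const 0 0).congr_of_eventuallyEq (hev.mono fun t ht => ht.1))
    · refine IsLocalMin.hasDerivAt_eq_zero ?_ hc2
      filter_upwards [hev] with t ht
      simpa [hc0] using ht.2
  -- The derivative of the transition map between the two hyperplanes is injective, hence surjective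
  -- by dimension, yet its `j`-th component is zero.
  let T : (Fin d → ℝ) →ₗ[ℝ] (Fin d → ℝ) :=
    LinearMap.snd ℝ ℝ (Fin d → ℝ) ∘ₗ (B.comp A).toLinearMap ∘ₗ LinearMap.inr ℝ ℝ (Fin d → ℝ)
  have hT : ∀ v, T v = (B (A (0, v))).2 := fun v => rfl
  have hTinj : Function.Injective T := by
    intro v w hvw
    have : B (A (0, v)) = B (A (0, w)) :=
      Prod.ext ((key v).1.trans (key w).1.symm) hvw
    exact (Prod.ext_iff.1 (hinjA (hinjB this))).2
  obtain ⟨v, hv⟩ := LinearMap.surjective_of_injective hTinj (Pi.single j 1)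
  have := congrFun hv j
  rw [hT, (key v).2, Pi.single_eq_same] at this
  exact zero_ne_one this

theorem cornerBoundary_horoFace {d : ℕ} (lam : Fin d → ℝ) (a : FaceIndex d) :
    cornerBoundary (horoFace lam a) =
      ⋃ b : {b : FaceIndex d // b ≠ a}, (horoFace lam a ∩ horoFace lam b.1) := by
  ext p
  simp only [cornerBoundary, mem_ofPred_eq, mem_iUnion, mem_inter_iff, Subtype.exists]
  constructor
  · rintro ⟨hp, J, hJ, hJp⟩
    have hne : (faceCornerSet lam a p).Nonempty := by
      by_contra h
      rw [Finset.not_nonempty_iff_eq_empty] at h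
      have h1 := hasCornerChart_horoFace lam a hp
      rw [h] at h1
      exact hJ.ne_empty (h1.eq_empty hJp)
    obtain ⟨b, hb, hpb⟩ := (faceCornerSet_nonempty_iff lam a hp).1 hne
    exact ⟨b, hb, hp, hpb⟩
  · rintro ⟨b, hb, hp, hpb⟩
    exact ⟨hp, _, (faceCornerSet_nonempty_iff lam a hp).2 ⟨b, hb, hpb⟩,
      hasCornerChart_horoFace lam a hp⟩

/-! ### A lower bound for lengths of curves -/

theorem exp_mul_sq_le_heintzeInner {d : ℕ} (lam : Fin d → ℝ) (p v : HeintzePoint d) (i : Fin d) :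
    Real.exp (-2 * lam i * p.1) * (v.2 i * v.2 i) ≤ heintzeInner lam p v v := by
  have h := Finset.single_le_sum
    (f := fun j => Real.exp (-2 * lam j * p.1) * (v.2 j * v.2 j))
    (fun j _ => mul_nonneg (Real.exp_pos _).le (mul_self_nonneg _)) (Finset.mem_univ i)
  have h' := mul_self_nonneg v.1
  rw [heintzeInner]
  linarith

theorem heintzeInner_self_nonneg {d : ℕ} (lam : Fin d → ℝ) (p v : HeintzePoint d) :
    0 ≤ heintzeInner lam p v v :=
  add_nonneg (mul_self_nonneg _) (Finset.sum_nonneg fun _ _ =>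
    mul_nonneg (Real.exp_pos _).le (mul_self_nonneg _))

/-- The infinitesimal form of `e^{-l y/2}` being 1-Lipschitz. On a lateral face the `dx_i²` term
alone contributes `e^{-λ_i y}(λ_i v/2)²`, where `v` is the `y`-velocity, and this dominates `e^{-l
y}(l v/2)²` because `y ≤ 0` and `l ≤ λ_i`. The face equation holds only for times in `A`; unique
differentiability is what allows differentiating it there. -/
theorem abs_deriv_exp_le_heintzeNorm {d : ℕ} {lam : Fin d → ℝ} {l : ℝ} (hl : 0 ≤ l)
    (hlam : ∀ i, l ≤ lam i) {γ : ℝ → HeintzePoint d} {v : HeintzePoint d} {t : ℝ}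
    (hγ : HasDerivAt γ v t) {a : FaceIndex d} {A : Set ℝ} (hA : ∀ s ∈ A, γ s ∈ horoFace lam a)
    (htA : t ∈ A) (hu : UniqueDiffWithinAt ℝ A t) :
    |Real.exp (-(l * (γ t).1 / 2)) * (-(l * v.1 / 2))| ≤ heintzeNorm lam (γ t) v := by
  have h1 : HasDerivAt (fun s => (γ s).1) v.1 t := hγ.fst
  refine Real.abs_le_sqrt ?_
  rcases a with _ | ⟨i, s⟩
  · have h0 : HasDerivWithinAt (fun s => (γ s).1) 0 A t :=
      (hasDerivWithinAt_const t A (0 : ℝ)).congr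
        (fun x hx => (mem_horoFace_none_iff.1 (hA x hx)).1)
        (mem_horoFace_none_iff.1 (hA t htA)).1
    rw [hu.eq_deriv _ h1.hasDerivWithinAt h0]
    simpa using heintzeInner_self_nonneg lam (γ t) v
  · have h2 : HasDerivAt (fun s => (γ s).2 i) (v.2 i) t := hasDerivAt_pi.1 hγ.snd i
    have h3 : HasDerivAt (fun x => faceSign s * Real.exp (lam i * (γ x).1 / 2))
        (faceSign s * (Real.exp (lam i * (γ t).1 / 2) * (lam i * v.1 / 2))) t :=
      (((h1.const_mul (lam i)).div_const 2).exp).const_mul _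
    have h4 : HasDerivWithinAt (fun s => (γ s).2 i) _ A t :=
      h3.hasDerivWithinAt.congr (fun x hx => (mem_horoFace_some_iff.1 (hA x hx)).2.2)
        (mem_horoFace_some_iff.1 (hA t htA)).2.2
    have h5 : v.2 i = _ := hu.eq_deriv _ h2.hasDerivWithinAt h4
    refine le_trans ?_ (exp_mul_sq_le_heintzeInner lam (γ t) v i)
    have hy : (γ t).1 ≤ 0 := fst_nonpos_of_mem_horoFace (hA t htA)
    rw [h5]
    set y := (γ t).1
    have e1 : Real.exp (-2 * lam i * y) *
        (faceSign s * (Real.exp (lam i * y / 2) * (lam i * v.1 / 2)) *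
          (faceSign s * (Real.exp (lam i * y / 2) * (lam i * v.1 / 2)))) =
        Real.exp (-(lam i * y)) * (lam i ^ 2 * (v.1 / 2) ^ 2) := by
      have : Real.exp (-2 * lam i * y) * (Real.exp (lam i * y / 2) * Real.exp (lam i * y / 2)) =
          Real.exp (-(lam i * y)) := by
        rw [← Real.exp_add, ← Real.exp_add]; congr 1; ring
      rw [← this]
      linear_combination (Real.exp (-2 * lam i * y) *
        (Real.exp (lam i * y / 2) * Real.exp (lam i * y / 2)) * (lam i ^ 2 * (v.1 / 2) ^ 2)) *
        faceSign_mul_self s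
    have e2 : (Real.exp (-(l * y / 2)) * (-(l * v.1 / 2))) ^ 2 =
        Real.exp (-(l * y)) * (l ^ 2 * (v.1 / 2) ^ 2) := by
      have : Real.exp (-(l * y)) = Real.exp (-(l * y / 2)) ^ 2 := by
        rw [sq, ← Real.exp_add]; congr 1; ring
      rw [this]; ring
    rw [e1, e2]
    have := hlam i
    gcongr ?_ * (?_ * _)
    · exact Real.exp_le_exp.2 (by nlinarith)
    · gcongr

/-- Only countably many points of `A` are isolated in it from the right, and on the line unique
differentiability means being an accumulation point. It is needed because a curve may switch faces
on a complicated set of times. -/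
theorem ae_mem_imp_uniqueDiffWithinAt (A : Set ℝ) :
    ∀ᵐ t : ℝ, t ∈ A → UniqueDiffWithinAt ℝ A t := by
  have h : (volume : Measure ℝ) {t ∈ A | nhdsWithin t (A ∩ Ioi t) = ⊥} = 0 :=
    countable_setOfPred_isolated_right_within.measure_zero _
  filter_upwards [measure_eq_zero_iff_ae_notMem.1 h] with t ht htA
  have ht' : (nhdsWithin t (A ∩ Ioi t)).NeBot := ⟨fun h' => ht ⟨htA, h'⟩⟩
  rw [uniqueDiffWithinAt_iff_accPt, accPt_principal_iff_nhdsWithin]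
  exact ht'.mono (nhdsWithin_mono _ fun x hx => ⟨hx.1, ne_of_gt hx.2⟩)

theorem exp_sub_exp_le_curveLength {d : ℕ} {lam : Fin d → ℝ} {l : ℝ} (hl : 0 ≤ l)
    (hlam : ∀ i, l ≤ lam i) {p q : HeintzePoint d} {γ : ℝ → HeintzePoint d}
    (hγ : IsLipschitzCurveIn (approxHorosphere lam) p q γ) :
    ENNReal.ofReal (Real.exp (-(l * q.1 / 2)) - Real.exp (-(l * p.1 / 2))) ≤
      curveLength lam γ := by
  obtain ⟨⟨K, hK⟩, hX, rfl, rfl⟩ := hγ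
  let f : ℝ → ℝ := fun t => Real.exp (-(l * (γ t).1 / 2))
  have hy : LipschitzOnWith (1 * K) (fun t => (γ t).1) (Icc 0 1) :=
    LipschitzWith.prod_fst.comp_lipschitzOnWith hK
  -- The exponential is only locally Lipschitz, but the curve has compact range.
  obtain ⟨K', hK'⟩ : ∃ K', LipschitzOnWith K' f (Icc 0 1) := by
    have hc : IsCompact ((fun t => (γ t).1) '' Icc 0 1) :=
      isCompact_Icc.image_of_continuousOn hy.continuousOn
    obtain ⟨R, hR⟩ := hc.isBounded.subset_closedBall 0
    have hg : ContDiff ℝ 1 fun y : ℝ => Real.exp (-(l * y / 2)) := by fun_prop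
    obtain ⟨K₂, hK₂⟩ := hg.contDiffOn.exists_lipschitzOnWith one_ne_zero
      (convex_closedBall 0 R) (isCompact_closedBall 0 R)
    exact ⟨_, hK₂.comp hy fun t ht => hR ⟨t, ht, rfl⟩⟩
  have hFTC : ∫ t in (0 : ℝ)..1, deriv f t = f 1 - f 0 :=
    AbsolutelyContinuousOnInterval.integral_deriv_eq_sub
      (LipschitzOnWith.absolutelyContinuousOnInterval (by rwa [uIcc_of_le zero_le_one]))
  rw [intervalIntegral.integral_of_le zero_le_one] at hFTC
  change ENNReal.ofReal (f 1 - f 0) ≤ _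
  rw [← hFTC, curveLength, restrict_Ioo_eq_restrict_Ioc]
  refine (Real.ofReal_le_enorm _).trans ((enorm_integral_le_lintegral_enorm _).trans ?_)
  rw [← restrict_Ioo_eq_restrict_Ioc]
  refine lintegral_mono_ae ((ae_restrict_iff' measurableSet_Ioo).2 ?_)
  filter_upwards [hK.ae_differentiableWithinAt_of_mem_real,
    ae_all_iff.2 fun a : FaceIndex d => ae_mem_imp_uniqueDiffWithinAt (γ ⁻¹' horoFace lam a)]
    with t ht1 ht2 ht
  have hd : DifferentiableAt ℝ γ t :=
    (ht1 (Ioo_subset_Icc_self ht)).differentiableAt (Icc_mem_nhds ht.1 ht.2)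
  have hm := hX t (Ioo_subset_Icc_self ht)
  rw [approxHorosphere_eq_iUnion, mem_iUnion] at hm
  obtain ⟨a, ha⟩ := hm
  have h1 : HasDerivAt (fun s => (γ s).1) (deriv γ t).1 t := hd.hasDerivAt.fst
  have hf : HasDerivAt f (Real.exp (-(l * (γ t).1 / 2)) * (-(l * (deriv γ t).1 / 2))) t :=
    (((h1.const_mul l).div_const 2).neg).exp
  rw [hf.deriv, Real.enorm_eq_ofReal_abs]
  exact ENNReal.ofReal_le_ofReal
    (abs_deriv_exp_le_heintzeNorm hl hlam hd.hasDerivAt (fun s hs => hs) ha (ht2 a ha))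

theorem exp_lt_of_mem_inducedBall {d : ℕ} {lam : Fin d → ℝ} {l : ℝ} (hl : 0 ≤ l)
    (hlam : ∀ i, l ≤ lam i) {p q : HeintzePoint d} {r : ℝ}
    (hq : q ∈ inducedBall lam (approxHorosphere lam) p r) :
    Real.exp (-(l * q.1 / 2)) < r + Real.exp (-(l * p.1 / 2)) := by
  obtain ⟨-, hr⟩ := hq
  simp only [inducedDist, iInf_lt_iff] at hr
  obtain ⟨γ, hγ, h⟩ := hr
  have h1 := (exp_sub_exp_le_curveLength hl hlam hγ).trans_lt h
  have := (ENNReal.ofReal_lt_ofReal_iff').1 h1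
  linarith

/-! ### Curves of bounded speed -/

/-- Some Lipschitz curve in `X` from `p` to `q` has speed at most `C`, up to countably many
parameters. -/
def IsJoinedWithSpeed {d : ℕ} (lam : Fin d → ℝ) (X : Set (HeintzePoint d)) (p q : HeintzePoint d)
    (C : ℝ) : Prop :=
  ∃ γ, IsLipschitzCurveIn X p q γ ∧
    {t ∈ Ioo (0 : ℝ) 1 | C < heintzeNorm lam (γ t) (deriv γ t)}.Countable

theorem IsJoinedWithSpeed.inducedDist_le {d : ℕ} {lam : Fin d → ℝ} {X : Set (HeintzePoint d)}
    {p q : HeintzePoint d} {C : ℝ} (h : IsJoinedWithSpeed lam X p q C) :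
    inducedDist lam X p q ≤ ENNReal.ofReal C := by
  obtain ⟨γ, hγ, hC⟩ := h
  refine (iInf₂_le γ hγ).trans ?_
  calc curveLength lam γ ≤ ∫⁻ _ in Ioo (0 : ℝ) 1, ENNReal.ofReal C := by
        refine lintegral_mono_ae ((ae_restrict_iff' measurableSet_Ioo).2 ?_)
        filter_upwards [measure_eq_zero_iff_ae_notMem.1 (hC.measure_zero volume)] with t ht ht'
        exact ENNReal.ofReal_le_ofReal (not_lt.1 fun h => ht ⟨ht', h⟩)
    _ = ENNReal.ofReal C := by simp

theorem IsJoinedWithSpeed.mono {d : ℕ} {lam : Fin d → ℝ} {X Y : Set (HeintzePoint d)}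
    {p q : HeintzePoint d} {C : ℝ} (h : IsJoinedWithSpeed lam X p q C) (hXY : X ⊆ Y) :
    IsJoinedWithSpeed lam Y p q C := by
  obtain ⟨γ, ⟨h1, h2, h3⟩, hC⟩ := h
  exact ⟨γ, ⟨h1, fun t ht => hXY (h2 t ht), h3⟩, hC⟩

theorem heintzeNorm_smul {d : ℕ} (lam : Fin d → ℝ) (p v : HeintzePoint d) {c : ℝ} (hc : 0 ≤ c) :
    heintzeNorm lam p (c • v) = c * heintzeNorm lam p v := by
  have : heintzeInner lam p (c • v) (c • v) = c ^ 2 * heintzeInner lam p v v := by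
    simp only [heintzeInner, Prod.smul_fst, Prod.smul_snd, Pi.smul_apply, smul_eq_mul, mul_add,
      Finset.mul_sum]
    congr 1
    · ring
    · exact Finset.sum_congr rfl fun _ _ => by ring
  rw [heintzeNorm, this, Real.sqrt_mul (sq_nonneg c), Real.sqrt_sq hc, heintzeNorm]

theorem LipschitzOnWith.Icc_union {E : Type*} [PseudoMetricSpace E] {f : ℝ → E} {K : NNReal}
    {a b c : ℝ} (h₁ : LipschitzOnWith K f (Icc a b)) (h₂ : LipschitzOnWith K f (Icc b c)) :
    LipschitzOnWith K f (Icc a c) := by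
  have key : ∀ x ∈ Icc a c, ∀ y ∈ Icc a c, x ≤ y → dist (f x) (f y) ≤ K * dist x y := by
    intro x hx y hy hxy
    rcases le_total y b with h | h
    · exact h₁.dist_le_mul x ⟨hx.1, hxy.trans h⟩ y ⟨hy.1, h⟩
    rcases le_total b x with h' | h'
    · exact h₂.dist_le_mul x ⟨h', hx.2⟩ y ⟨h, hy.2⟩
    · have e1 := h₁.dist_le_mul x ⟨hx.1, h'⟩ b ⟨hx.1.trans h', le_rfl⟩
      have e2 := h₂.dist_le_mul b ⟨le_rfl, h.trans hy.2⟩ y ⟨h, hy.2⟩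
      have e3 := dist_triangle (f x) (f b) (f y)
      rw [Real.dist_eq, abs_of_nonpos (by linarith)] at e1 e2 ⊢
      linarith
  refine LipschitzOnWith.of_dist_le_mul fun x hx y hy => ?_
  rcases le_total x y with h | h
  · exact key x hx y hy h
  · rw [dist_comm, dist_comm x]
    exact key y hy x hx h

/-- Each curve is run at double speed on half of the interval, whence the factor 2; the junction
`1/2` joins the countable exceptional set. -/
theorem IsJoinedWithSpeed.trans {d : ℕ} {lam : Fin d → ℝ} {X : Set (HeintzePoint d)}
    {p q r : HeintzePoint d} {C D : ℝ} (h₁ : IsJoinedWithSpeed lam X p q C)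
    (h₂ : IsJoinedWithSpeed lam X q r D) : IsJoinedWithSpeed lam X p r (2 * max C D) := by
  obtain ⟨α, ⟨⟨K, hK⟩, hαX, hα0, hα1⟩, hC⟩ := h₁
  obtain ⟨β, ⟨⟨L, hL⟩, hβX, hβ0, hβ1⟩, hD⟩ := h₂
  let γ : ℝ → HeintzePoint d := fun t => if t ≤ 1 / 2 then α (2 * t) else β (2 * t - 1)
  have hγ1 : ∀ t, t ≤ 1 / 2 → γ t = α (2 * t) := fun t ht => if_pos ht
  have hγ2 : ∀ t, 1 / 2 ≤ t → γ t = β (2 * t - 1) := by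
    intro t ht
    rcases ht.eq_or_lt with rfl | h
    · rw [hγ1 _ le_rfl]; norm_num [hα1, hβ0]
    · exact if_neg (not_le.2 h)
  refine ⟨γ, ⟨⟨2 * max K L, LipschitzOnWith.Icc_union (b := 1 / 2) ?_ ?_⟩, ?_, ?_, ?_⟩, ?_⟩
  · refine LipschitzOnWith.of_dist_le_mul fun x hx y hy => ?_
    rw [hγ1 x hx.2, hγ1 y hy.2]
    refine (hK.dist_le_mul _ ⟨by linarith [hx.1], by linarith [hx.2]⟩ _
      ⟨by linarith [hy.1], by linarith [hy.2]⟩).trans ?_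
    rw [Real.dist_eq, Real.dist_eq, ← mul_sub, abs_mul, abs_two, ← mul_assoc, NNReal.coe_mul,
      mul_comm (K : ℝ)]
    gcongr
    · exact le_rfl
    · exact le_max_left _ _
  · refine LipschitzOnWith.of_dist_le_mul fun x hx y hy => ?_
    rw [hγ2 x hx.1, hγ2 y hy.1]
    refine (hL.dist_le_mul _ ⟨by linarith [hx.1], by linarith [hx.2]⟩ _
      ⟨by linarith [hy.1], by linarith [hy.2]⟩).trans ?_
    rw [Real.dist_eq, Real.dist_eq, sub_sub_sub_cancel_right, ← mul_sub, abs_mul, abs_two,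
      ← mul_assoc, NNReal.coe_mul, mul_comm (L : ℝ)]
    gcongr
    · exact le_rfl
    · exact le_max_right _ _
  · intro t ht
    rcases le_total t (1 / 2) with h | h
    · rw [hγ1 t h]; exact hαX _ ⟨by linarith [ht.1], by linarith⟩
    · rw [hγ2 t h]; exact hβX _ ⟨by linarith, by linarith [ht.2]⟩
  · rw [hγ1 0 (by norm_num), mul_zero, hα0]
  · rw [hγ2 1 (by norm_num)]; norm_num [hβ1]
  · refine (((hC.image fun t => t / 2).union (hD.image fun t => (t + 1) / 2)).union
      (countable_singleton (1 / 2))).mono ?_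
    rintro t ⟨ht, htC⟩
    rcases lt_trichotomy t (1 / 2) with h | h | h
    · refine Or.inl (Or.inl ⟨2 * t, ⟨⟨by linarith [ht.1], by linarith⟩, ?_⟩, by ring⟩)
      have he : γ =ᶠ[nhds t] fun t => α (2 * t) := by
        filter_upwards [Iio_mem_nhds h] with s hs using hγ1 s (le_of_lt hs)
      rw [he.deriv_eq, he.eq_of_nhds, deriv_comp_mul_left,
        heintzeNorm_smul _ _ _ zero_le_two] at htC
      linarith [le_max_left C D]
    · exact Or.inr h
    · refine Or.inl (Or.inr ⟨2 * t - 1, ⟨⟨by linarith, by linarith [ht.2]⟩, ?_⟩, by ring⟩)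
      have he : γ =ᶠ[nhds t] fun t => (fun x => β (x - 1)) (2 * t) := by
        filter_upwards [Ioi_mem_nhds h] with s hs using hγ2 s (le_of_lt hs)
      rw [he.deriv_eq, he.eq_of_nhds, deriv_comp_mul_left (f := fun x => β (x - 1)),
        deriv_comp_sub_const,
        heintzeNorm_smul _ _ _ zero_le_two] at htC
      linarith [le_max_right C D]

theorem isJoinedWithSpeed_horoFace_none {d : ℕ} (lam : Fin d → ℝ) {p q : HeintzePoint d}
    (hp : p ∈ horoFace lam none) (hq : q ∈ horoFace lam none) :
    IsJoinedWithSpeed lam (horoFace lam none) p q (Real.sqrt (d * 4)) := by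
  rw [mem_horoFace_none_iff] at hp hq
  let γ : ℝ → HeintzePoint d := fun t => p + t • (q - p)
  have hγ : ∀ t, HasDerivAt γ (q - p) t := by
    intro t
    have := ((hasDerivAt_id t).smul_const (q - p)).const_add p
    rwa [one_smul] at this
  have hc : ContDiff ℝ 1 γ := by fun_prop
  refine ⟨γ, ⟨hc.contDiffOn.exists_lipschitzOnWith one_ne_zero (convex_Icc 0 1) isCompact_Icc,
    ?_, by simp [γ], by simp [γ]⟩, ?_⟩
  · intro t ht
    rw [mem_horoFace_none_iff]
    refine ⟨by simp [γ, hp.1, hq.1], fun i => ?_⟩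
    have h1 := abs_le.1 (hp.2 i)
    have h2 := abs_le.1 (hq.2 i)
    simp only [γ, Prod.snd_add, Prod.smul_snd, Prod.snd_sub, Pi.add_apply, Pi.smul_apply,
      Pi.sub_apply, smul_eq_mul]
    rw [abs_le]
    constructor <;> nlinarith [ht.1, ht.2]
  · convert countable_empty
    rw [eq_empty_iff_forall_notMem]
    rintro t ⟨-, ht⟩
    rw [(hγ t).deriv] at ht
    refine absurd ht (not_lt.2 (Real.sqrt_le_sqrt ?_))
    have h0 : (γ t).1 = 0 := by simp [γ, hp.1, hq.1]
    simp only [heintzeInner, h0, Prod.fst_sub, hp.1, hq.1, sub_self, mul_zero, Real.exp_zero,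
      one_mul, zero_add, Prod.snd_sub, Pi.sub_apply]
    refine (Finset.sum_le_card_nsmul _ _ 4 fun i _ => ?_).trans (by simp)
    have h1 := abs_le.1 (hp.2 i)
    have h2 := abs_le.1 (hq.2 i)
    nlinarith

/-- The curve of slope `±1` in the coordinate `w = e^{-λ_i y / 2}` along a lateral face. -/
theorem isJoinedWithSpeed_horoFace_some {d : ℕ} {lam : Fin d → ℝ} (hpos : ∀ i, 0 < lam i)
    (i : Fin d) (s : Bool) (u : Fin d → ℝ) {w₀ w₁ W : ℝ} (h₀ : 1 ≤ w₀) (h₁ : 1 ≤ w₁)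
    (h₀W : w₀ ≤ W) (h₁W : w₁ ≤ W)
    (hu : ∀ j, j ≠ i → |u j| ≤ Real.exp (lam j * (-(2 / lam i) * Real.log W) / 2)) :
    IsJoinedWithSpeed lam (horoFace lam (some (i, s)))
      (-(2 / lam i) * Real.log w₀, Function.update u i (faceSign s * w₀⁻¹))
      (-(2 / lam i) * Real.log w₁, Function.update u i (faceSign s * w₁⁻¹))
      ((1 + 2 / lam i) * |w₁ - w₀|) := by
  have hi := hpos i
  let w : ℝ → ℝ := fun t => w₀ + t * (w₁ - w₀)
  have hw : ∀ t, HasDerivAt w (w₁ - w₀) t := by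
    intro t
    have := ((hasDerivAt_id t).mul_const (w₁ - w₀)).const_add w₀
    rwa [one_mul] at this
  have hw1 : ∀ t ∈ Icc (0 : ℝ) 1, 1 ≤ w t := fun t ht => by
    simp only [w]; nlinarith [ht.1, ht.2]
  have hwW : ∀ t ∈ Icc (0 : ℝ) 1, w t ≤ W := fun t ht => by
    simp only [w]; nlinarith [ht.1, ht.2]
  let γ : ℝ → HeintzePoint d := fun t =>
    (-(2 / lam i) * Real.log (w t), Function.update u i (faceSign s * (w t)⁻¹))
  have hγ : ∀ t ∈ Icc (0 : ℝ) 1, HasDerivAt γ (-(2 / lam i) * ((w₁ - w₀) / w t),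
      Pi.single i (faceSign s * (-(w₁ - w₀) / w t ^ 2))) t := by
    intro t ht
    have hne : w t ≠ 0 := by linarith [hw1 t ht]
    refine HasDerivAt.prodMk (((hw t).log hne).const_mul _) (hasDerivAt_pi.2 fun j => ?_)
    by_cases h : j = i
    · subst h
      simpa using ((hw t).fun_inv hne).const_mul (faceSign s)
    · simpa [h] using hasDerivAt_const t (u j)
  have hc : ContDiffOn ℝ 1 γ (Icc 0 1) := by
    have hwc : ContDiffOn ℝ 1 w (Icc 0 1) := by fun_prop
    have hne : ∀ t ∈ Icc (0 : ℝ) 1, w t ≠ 0 := fun t ht => by linarith [hw1 t ht]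
    refine ContDiffOn.prodMk (contDiffOn_const.mul (hwc.log hne)) (contDiffOn_pi.2 fun j => ?_)
    by_cases h : j = i
    · subst h
      simpa using contDiffOn_const.mul (hwc.inv hne)
    · simpa [h] using contDiffOn_const
  refine ⟨γ, ⟨hc.exists_lipschitzOnWith one_ne_zero (convex_Icc 0 1) isCompact_Icc,
    ?_, by simp [γ, w], by simp [γ, w]⟩, ?_⟩
  · intro t ht
    have hpos' : 0 < w t := by linarith [hw1 t ht]
    rw [mem_horoFace_some_iff]
    refine ⟨?_, fun j hj => ?_, ?_⟩
    · simp only [γ, neg_mul, neg_nonpos]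
      exact mul_nonneg (by positivity) (Real.log_nonneg (hw1 t ht))
    · simp only [γ, Function.update_of_ne hj]
      -- The box shrinks with depth, so it suffices that `u` fits at the deepest level `W`.
      refine (hu j hj).trans (Real.exp_le_exp.2 ?_)
      have h1 : Real.log (w t) ≤ Real.log W := Real.log_le_log hpos' (hwW t ht)
      have h2 := hpos j
      have h3 : 2 / lam i * Real.log (w t) ≤ 2 / lam i * Real.log W := by gcongr
      have h4 := mul_le_mul_of_nonneg_left h3 h2.le
      linarith
    · have : lam i * (-(2 / lam i) * Real.log (w t)) / 2 = -Real.log (w t) := by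
        field_simp
      simp only [γ, Function.update_self]
      rw [this, Real.exp_neg, Real.exp_log hpos']
  · convert countable_empty
    rw [eq_empty_iff_forall_notMem]
    rintro t ⟨ht', ht⟩
    have htI := Ioo_subset_Icc_self ht'
    have hw1' := hw1 t htI
    have hpos' : 0 < w t := by linarith
    rw [(hγ t htI).deriv] at ht
    refine absurd ht (not_lt.2 (Real.sqrt_le_iff.2 ⟨by positivity, ?_⟩))
    -- Since `x_i = ±1/w`, the factor `w⁴` makes the `dx_i²` term exactly `dw²`, while `w ≥ 1`
    -- bounds the `dy²` term by `(2/λ_i)² dw²`.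
    have e1 : Real.exp (-2 * lam i * (γ t).1) = w t ^ 4 := by
      have : -2 * lam i * (γ t).1 = (4 : ℕ) * Real.log (w t) := by
        simp only [γ]; field_simp; push_cast; ring
      rw [this, Real.exp_nat_mul, Real.exp_log hpos']
    rw [heintzeInner, Finset.sum_eq_single i (fun j _ hj => by simp [hj])
      (fun h => absurd (Finset.mem_univ i) h), e1]
    simp only [Pi.single_eq_same]
    have e2 : w t ^ 4 * (faceSign s * (-(w₁ - w₀) / w t ^ 2) *
        (faceSign s * (-(w₁ - w₀) / w t ^ 2))) = (w₁ - w₀) ^ 2 := by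
      have : w t ^ 4 * (-(w₁ - w₀) / w t ^ 2) ^ 2 = (w₁ - w₀) ^ 2 := by
        field_simp
      rw [← this]
      linear_combination (w t ^ 4 * (-(w₁ - w₀) / w t ^ 2) ^ 2) * faceSign_mul_self s
    have e3 : -(2 / lam i) * ((w₁ - w₀) / w t) * (-(2 / lam i) * ((w₁ - w₀) / w t)) ≤
        (2 / lam i) ^ 2 * (w₁ - w₀) ^ 2 := by
      have h1 : ((w₁ - w₀) / w t) ^ 2 ≤ (w₁ - w₀) ^ 2 := by
        rw [div_pow]
        exact div_le_self (sq_nonneg _) (one_le_pow₀ hw1')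
      calc _ = (2 / lam i) ^ 2 * ((w₁ - w₀) / w t) ^ 2 := by ring
        _ ≤ _ := by gcongr
    rw [e2, mul_pow, sq_abs]
    have : 0 ≤ 2 / lam i * (w₁ - w₀) ^ 2 := by positivity
    nlinarith

/-- The point slides up to `y = 0` with the other `x_j` frozen, which is allowed because the boxes
widen upwards. Both directions are recorded since a path may start or end at the lateral point. -/
theorem isJoinedWithSpeed_top {d : ℕ} {lam : Fin d → ℝ} (hpos : ∀ i, 0 < lam i)
    {i : Fin d} {s : Bool} {p : HeintzePoint d} (hp : p ∈ horoFace lam (some (i, s))) :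
    ∃ p' ∈ horoFace lam none,
      IsJoinedWithSpeed lam (horoFace lam (some (i, s))) p p'
        ((1 + 2 / lam i) * (Real.exp (-(lam i * p.1 / 2)) - 1)) ∧
      IsJoinedWithSpeed lam (horoFace lam (some (i, s))) p' p
        ((1 + 2 / lam i) * (Real.exp (-(lam i * p.1 / 2)) - 1)) := by
  have hi := hpos i
  have hle := abs_apply_le_of_mem_horoFace hp
  have hp' := mem_horoFace_some_iff.1 hp
  set W := Real.exp (-(lam i * p.1 / 2)) with hW
  have hW1 : 1 ≤ W := Real.one_le_exp (by nlinarith [hp'.1])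
  have hlog : -(2 / lam i) * Real.log W = p.1 := by
    rw [hW, Real.log_exp]; field_simp
  have hu : ∀ j, j ≠ i → |p.2 j| ≤ Real.exp (lam j * (-(2 / lam i) * Real.log W) / 2) := by
    intro j _
    rw [hlog]; exact hle j
  have hpe : (-(2 / lam i) * Real.log W, Function.update p.2 i (faceSign s * W⁻¹)) = p := by
    have : faceSign s * W⁻¹ = p.2 i := by rw [hW, ← Real.exp_neg, neg_neg, hp'.2.2]
    rw [hlog, this, Function.update_eq_self]
  refine ⟨(0, Function.update p.2 i (faceSign s)), ?_, ?_, ?_⟩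
  · refine mem_horoFace_none_iff.2 ⟨rfl, fun j => ?_⟩
    by_cases h : j = i
    · subst h; simp [abs_faceSign]
    · simp only [Function.update_of_ne h]
      exact (hle j).trans (Real.exp_le_one_iff.2 (by nlinarith [hp'.1, hpos j]))
  · have := isJoinedWithSpeed_horoFace_some hpos i s p.2 hW1 le_rfl le_rfl hW1 hu
    rw [hpe, abs_of_nonpos (by linarith), neg_sub] at this
    simpa using this
  · have := isJoinedWithSpeed_horoFace_some hpos i s p.2 le_rfl hW1 hW1 le_rfl hu
    rw [hpe, abs_of_nonneg (by linarith)] at this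
    simpa using this

theorem horoFace_subset_approxHorosphere {d : ℕ} (lam : Fin d → ℝ) (a : FaceIndex d) :
    horoFace lam a ⊆ approxHorosphere lam := by
  rw [approxHorosphere_eq_iUnion]
  exact subset_iUnion _ a

theorem exists_isJoinedWithSpeed_horoFace_none {d : ℕ} {lam : Fin d → ℝ} (hpos : ∀ i, 0 < lam i)
    {p : HeintzePoint d} (hp : p ∈ approxHorosphere lam) :
    ∃ C, ∀ q ∈ horoFace lam none, IsJoinedWithSpeed lam (approxHorosphere lam) p q C := by
  rw [approxHorosphere_eq_iUnion, mem_iUnion] at hp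
  obtain ⟨_ | ⟨i, s⟩, hp⟩ := hp
  · exact ⟨_, fun q hq => (isJoinedWithSpeed_horoFace_none lam hp hq).mono
      (horoFace_subset_approxHorosphere lam _)⟩
  · obtain ⟨p', hp', h, -⟩ := isJoinedWithSpeed_top hpos hp
    exact ⟨_, fun q hq => (h.mono (horoFace_subset_approxHorosphere lam _)).trans
      ((isJoinedWithSpeed_horoFace_none lam hp' hq).mono
        (horoFace_subset_approxHorosphere lam _))⟩

theorem exists_inducedDist_le {d : ℕ} {lam : Fin d → ℝ} (hpos : ∀ i, 0 < lam i)
    {p : HeintzePoint d} (hp : p ∈ approxHorosphere lam) :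
    ∃ C : ℝ, ∀ i s, ∀ q ∈ horoFace lam (some (i, s)),
      inducedDist lam (approxHorosphere lam) p q ≤
        ENNReal.ofReal (2 * max C ((1 + 2 / lam i) * (Real.exp (-(lam i * q.1 / 2)) - 1))) := by
  obtain ⟨C, hC⟩ := exists_isJoinedWithSpeed_horoFace_none hpos hp
  refine ⟨C, fun i s q hq => ?_⟩
  obtain ⟨q', hq', -, h⟩ := isJoinedWithSpeed_top hpos hq
  exact ((hC q' hq').trans (h.mono (horoFace_subset_approxHorosphere lam _))).inducedDist_le

theorem inducedDist_approxHorosphere_lt_top {d : ℕ} {lam : Fin d → ℝ} (hpos : ∀ i, 0 < lam i)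
    {p q : HeintzePoint d} (hp : p ∈ approxHorosphere lam) (hq : q ∈ approxHorosphere lam) :
    inducedDist lam (approxHorosphere lam) p q < ⊤ := by
  rw [approxHorosphere_eq_iUnion, mem_iUnion] at hq
  obtain ⟨_ | ⟨i, s⟩, hq⟩ := hq
  · obtain ⟨C, hC⟩ := exists_isJoinedWithSpeed_horoFace_none hpos hp
    exact (hC q hq).inducedDist_le.trans_lt ENNReal.ofReal_lt_top
  · obtain ⟨C, hC⟩ := exists_inducedDist_le hpos hp
    exact (hC i s q hq).trans_lt ENNReal.ofReal_lt_top

/-! ### Volumes of the faces -/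

theorem paramVolume_apply {d : ℕ} (lam : Fin d → ℝ) {φ : (Fin d → ℝ) → HeintzePoint d}
    (hφ : Measurable φ) (F : Set (HeintzePoint d)) {S : Set (HeintzePoint d)}
    (hS : MeasurableSet S) :
    paramVolume lam φ F S =
      ∫⁻ u in φ ⁻¹' (S ∩ F), ENNReal.ofReal (Real.sqrt (pullbackGram lam φ u).det) := by
  rw [paramVolume, Measure.map_apply hφ hS, withDensity_apply _ (hφ hS),
    Measure.restrict_restrict (hφ hS), preimage_inter]

theorem continuous_faceParam {d : ℕ} (lam : Fin d → ℝ) (a : FaceIndex d) :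
    Continuous (faceParam lam a) := by
  rcases a with _ | ⟨i, s⟩
  · exact (Continuous.prodMk_right (0 : ℝ))
  · exact Continuous.prodMk (by fun_prop) (continuous_id.update i (by fun_prop))

theorem isClosed_horoFace {d : ℕ} (lam : Fin d → ℝ) (a : FaceIndex d) :
    IsClosed (horoFace lam a) := by
  rcases a with _ | ⟨i, s⟩
  · simp only [horoFace, ofPred_and, ofPred_forall]
    exact (isClosed_eq (by fun_prop) (by fun_prop)).inter
      (isClosed_iInter fun i => isClosed_le (by fun_prop) (by fun_prop))
  · simp only [horoFace, ofPred_and, ofPred_forall]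
    exact (isClosed_le (by fun_prop) (by fun_prop)).inter
      ((isClosed_iInter fun i => isClosed_iInter fun _ =>
        isClosed_le (by fun_prop) (by fun_prop)).inter
      (isClosed_eq (by fun_prop) (by fun_prop)))

theorem pullbackGram_faceParam_none {d : ℕ} (lam : Fin d → ℝ) (u : Fin d → ℝ) :
    pullbackGram lam (faceParam lam none) u = 1 := by
  have h : fderiv ℝ (faceParam lam none) u = ContinuousLinearMap.inr ℝ ℝ (Fin d → ℝ) :=
    (hasFDerivAt_prodMk_right (0 : ℝ) u).fderiv
  ext a b
  rw [pullbackGram, Matrix.of_apply, h]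
  simp [heintzeInner, faceParam, Matrix.one_apply, Pi.single_apply, eq_comm]

/-- The matrix is diagonal because the parameter `u i` moves only `y` and `x_i`, and every other
parameter moves only its own `x_a`. -/
theorem pullbackGram_faceParam_some {d : ℕ} (lam : Fin d → ℝ) (i : Fin d) (s : Bool)
    (u : Fin d → ℝ) :
    pullbackGram lam (faceParam lam (some (i, s))) u =
      Matrix.diagonal fun a => if a = i then 1 + (lam i / 2) ^ 2 * Real.exp (-(lam i * u i))
        else Real.exp (-(lam a * u i)) ^ 2 := by
  set c : ℝ := faceSign s * (Real.exp (lam i * u i / 2) * (lam i / 2)) with hc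
  let L : (Fin d → ℝ) →L[ℝ] HeintzePoint d :=
    (ContinuousLinearMap.proj i).prod (ContinuousLinearMap.pi fun j =>
      (if j = i then c else 1) • ContinuousLinearMap.proj j)
  have hL : HasFDerivAt (faceParam lam (some (i, s))) L u := by
    refine HasFDerivAt.prodMk (hasFDerivAt_apply i u) (hasFDerivAt_pi.2 fun j => ?_)
    by_cases h : j = i
    · subst h
      have h1 := ((((hasFDerivAt_apply (𝕜 := ℝ) j u).const_mul (lam j)).mul_const
        (2⁻¹ : ℝ)).exp).const_mul (faceSign s)
      simp only [Function.update_self, if_true]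
      refine h1.congr_fderiv ?_
      ext v
      simp [hc, div_eq_mul_inv]
      ring
    · simpa [h] using hasFDerivAt_apply (𝕜 := ℝ) j u
  have hc2 : Real.exp (-2 * lam i * u i) * (c * c) =
      (lam i / 2) ^ 2 * Real.exp (-(lam i * u i)) := by
    have : Real.exp (-2 * lam i * u i) * (Real.exp (lam i * u i / 2) * Real.exp (lam i * u i / 2)) =
        Real.exp (-(lam i * u i)) := by
      rw [← Real.exp_add, ← Real.exp_add]; congr 1; ring
    rw [hc, ← this]
    linear_combination (Real.exp (-2 * lam i * u i) *
      (Real.exp (lam i * u i / 2) * Real.exp (lam i * u i / 2)) * (lam i / 2) ^ 2) *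
        faceSign_mul_self s
  have he : ∀ a, Real.exp (-2 * lam a * u i) = Real.exp (-(lam a * u i)) ^ 2 := fun a => by
    rw [sq, ← Real.exp_add]; congr 1; ring
  ext a b
  rw [pullbackGram, Matrix.of_apply, hL.fderiv, Matrix.diagonal_apply]
  have hLa : ∀ a : Fin d, L (Pi.single a 1) =
      (Pi.single (M := fun _ => ℝ) a 1 i,
        Pi.single (M := fun _ => ℝ) a (if a = i then c else 1)) := by
    intro a
    ext j
    · rfl
    · have hLj : (L (Pi.single a 1)).2 j =
          (if j = i then c else 1) * Pi.single (M := fun _ => ℝ) a 1 j := rfl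
      rw [hLj]
      by_cases h : j = a
      · subst h; simp
      · simp [h]
  rw [heintzeInner, hLa, hLa]
  simp only
  rw [Finset.sum_eq_single a (fun j _ hj => by simp [hj])
    (fun h => absurd (Finset.mem_univ a) h)]
  by_cases hab : a = b
  · subst hab
    by_cases h : a = i
    · subst h
      simp [faceParam, ← hc2]
    · simpa [faceParam, h, Ne.symm h] using he a
  · by_cases h : a = i
    · subst h
      simp [hab]
    · simp [hab, Ne.symm h]

theorem sqrt_det_pullbackGram_some {n : ℕ} (lam : Fin (n + 1) → ℝ) (i : Fin (n + 1)) (s : Bool)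
    (u : Fin (n + 1) → ℝ) :
    Real.sqrt (pullbackGram lam (faceParam lam (some (i, s))) u).det =
      Real.sqrt (1 + (lam i / 2) ^ 2 * Real.exp (-(lam i * u i))) *
        ∏ k, Real.exp (-(lam (i.succAbove k) * u i)) := by
  rw [pullbackGram_faceParam_some, Matrix.det_diagonal, Fin.prod_univ_succAbove _ i]
  simp only [if_true, Fin.succAbove_ne, if_false, Finset.prod_pow]
  rw [Real.sqrt_mul (by positivity), Real.sqrt_sq (Finset.prod_nonneg fun _ _ => by positivity)]

/-- With `le_sqrt_one_add`, this replaces the vertical density factor by a multiple of `e^{-l y/2}`,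
so that all integrals become explicit. -/
theorem sqrt_one_add_le {a y : ℝ} (ha : 0 ≤ a) (hy : y ≤ 0) (l : ℝ) (hl : 0 ≤ l) :
    Real.sqrt (1 + a ^ 2 * Real.exp (-(l * y))) ≤ (1 + a) * Real.exp (-(l * y / 2)) := by
  have h1 : 1 ≤ Real.exp (-(l * y / 2)) := Real.one_le_exp (by nlinarith)
  have h2 : Real.exp (-(l * y)) = Real.exp (-(l * y / 2)) ^ 2 := by
    rw [sq, ← Real.exp_add]; congr 1; ring
  refine Real.sqrt_le_iff.2 ⟨by positivity, ?_⟩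
  rw [h2]
  nlinarith [one_le_pow₀ h1 (n := 2), mul_nonneg ha (sq_nonneg (Real.exp (-(l * y / 2))))]

theorem le_sqrt_one_add (a l y : ℝ) :
    a * Real.exp (-(l * y / 2)) ≤ Real.sqrt (1 + a ^ 2 * Real.exp (-(l * y))) := by
  have h2 : Real.exp (-(l * y)) = Real.exp (-(l * y / 2)) ^ 2 := by
    rw [sq, ← Real.exp_add]; congr 1; ring
  refine Real.le_sqrt_of_sq_le ?_
  rw [h2]
  nlinarith

theorem lintegral_exp_Icc {a T : ℝ} (ha : 0 < a) (hT : 0 ≤ T) :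
    ∫⁻ t in Icc (-T) 0, ENNReal.ofReal (Real.exp (-(a * t))) =
      ENNReal.ofReal (a⁻¹ * (Real.exp (a * T) - 1)) := by
  have hc : Continuous fun t : ℝ => Real.exp (-(a * t)) := by fun_prop
  rw [← ofReal_integral_eq_lintegral_ofReal hc.continuousOn.integrableOn_Icc
    (Filter.Eventually.of_forall fun _ => (Real.exp_pos _).le), integral_Icc_eq_integral_Ioc,
    ← intervalIntegral.integral_of_le (by linarith)]
  have hd : ∀ t ∈ uIcc (-T) 0,
      HasDerivAt (fun t => -a⁻¹ * Real.exp (-(a * t))) (Real.exp (-(a * t))) t := by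
    intro t _
    have := ((((hasDerivAt_id t).const_mul a).neg).exp).const_mul (-a⁻¹)
    refine this.congr_deriv ?_
    simp only [id, Pi.neg_apply]
    field_simp
  rw [intervalIntegral.integral_eq_sub_of_hasDerivAt hd (hc.intervalIntegrable _ _)]
  congr 1
  simp
  ring

/-- Integration over a slab whose section at height `t = u i` is a box with half-sides
`e^{λ_j t / 2}`. -/
theorem setLIntegral_slab {n : ℕ} (lam : Fin (n + 1) → ℝ) (i : Fin (n + 1)) (T : ℝ)
    {f : ℝ → ℝ≥0∞} (hf : Measurable f) :
    ∫⁻ u in {u : Fin (n + 1) → ℝ | u i ∈ Icc (-T) 0 ∧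
        ∀ k, |u (i.succAbove k)| ≤ Real.exp (lam (i.succAbove k) * u i / 2)}, f (u i) =
      ∫⁻ t in Icc (-T) 0, f t * ENNReal.ofReal
        (∏ k, (2 * Real.exp (lam (i.succAbove k) * t / 2))) := by
  let R : Set (ℝ × (Fin n → ℝ)) := {z | z.1 ∈ Icc (-T) 0 ∧
    ∀ k, |z.2 k| ≤ Real.exp (lam (i.succAbove k) * z.1 / 2)}
  have hR : MeasurableSet R := by
    have : IsClosed R := by
      simp only [R, ofPred_and, ofPred_forall]
      exact (isClosed_Icc.preimage continuous_fst).inter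
        (isClosed_iInter fun k => isClosed_le (by fun_prop) (by fun_prop))
    exact this.measurableSet
  have h := (volume_preserving_piFinSuccAbove (fun _ : Fin (n + 1) => ℝ) i).setLIntegral_comp_preimage
    hR (hf.comp measurable_fst)
  refine h.trans ?_
  rw [← lintegral_indicator hR, Measure.volume_eq_prod,
    lintegral_prod _ ((hf.comp measurable_fst).indicator hR).aemeasurable,
    ← lintegral_indicator measurableSet_Icc]
  congr 1
  ext t
  by_cases ht : t ∈ Icc (-T) 0
  · have hbox : ∀ v : Fin n → ℝ, R.indicator (f ∘ Prod.fst) (t, v) =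
        (Set.pi univ fun k => Icc (-Real.exp (lam (i.succAbove k) * t / 2))
          (Real.exp (lam (i.succAbove k) * t / 2))).indicator (fun _ => f t) v := by
      intro v
      have : (t, v) ∈ R ↔ v ∈ Set.pi univ fun k => Icc (-Real.exp (lam (i.succAbove k) * t / 2))
          (Real.exp (lam (i.succAbove k) * t / 2)) := by
        simp only [R, mem_ofPred_eq, ht, true_and, mem_univ_pi, ← abs_le, mem_Icc (a := -Real.exp _)]
      by_cases hv : (t, v) ∈ R
      · rw [indicator_of_mem hv, indicator_of_mem (this.1 hv)]; rfl
      · rw [indicator_of_notMem hv, indicator_of_notMem (mt this.2 hv)]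
    simp only [hbox]
    rw [lintegral_indicator (MeasurableSet.univ_pi fun _ => measurableSet_Icc),
      setLIntegral_const, indicator_of_mem ht, volume_pi_pi, ENNReal.ofReal_prod_of_nonneg
        (fun _ _ => by positivity)]
    congr 2
    ext k
    rw [Real.volume_Icc]
    congr 1
    ring
  · rw [indicator_of_notMem ht]
    refine (lintegral_congr fun v => ?_).trans lintegral_zero
    exact indicator_of_notMem (fun h => ht h.1) _

theorem faceParam_preimage_some {n : ℕ} (lam : Fin (n + 1) → ℝ) (i : Fin (n + 1)) (s : Bool)
    (T : ℝ) :
    faceParam lam (some (i, s)) ⁻¹' ({q | -T ≤ q.1} ∩ horoFace lam (some (i, s))) =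
      {u : Fin (n + 1) → ℝ | u i ∈ Icc (-T) 0 ∧
        ∀ k, |u (i.succAbove k)| ≤ Real.exp (lam (i.succAbove k) * u i / 2)} := by
  ext u
  rw [mem_preimage, mem_inter_iff, mem_horoFace_some_iff]
  simp only [faceParam, mem_ofPred_eq, mem_Icc, Function.update_self, and_true, and_assoc]
  refine and_congr_right fun _ => and_congr_right fun _ => ?_
  rw [Fin.forall_iff_succAbove i]
  simp

theorem setLIntegral_slab_exp {n : ℕ} {lam : Fin (n + 1) → ℝ} (hpos : ∀ i, 0 < lam i)
    (i : Fin (n + 1)) {T c : ℝ} (hT : 0 ≤ T) (hc : 0 ≤ c) :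
    ∫⁻ u in {u : Fin (n + 1) → ℝ | u i ∈ Icc (-T) 0 ∧
        ∀ k, |u (i.succAbove k)| ≤ Real.exp (lam (i.succAbove k) * u i / 2)},
        ENNReal.ofReal (c * Real.exp (-(lam i * u i / 2)) *
          ∏ k, Real.exp (-(lam (i.succAbove k) * u i))) =
      ENNReal.ofReal (c * 2 ^ n * (((∑ j, lam j) / 2)⁻¹ *
        (Real.exp ((∑ j, lam j) / 2 * T) - 1))) := by
  have hsum : 0 < ∑ j, lam j := Finset.sum_pos (fun j _ => hpos j) Finset.univ_nonempty
  rw [setLIntegral_slab lam i T (f := fun t => ENNReal.ofReal (c * Real.exp (-(lam i * t / 2)) *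
    ∏ k, Real.exp (-(lam (i.succAbove k) * t)))) (by fun_prop)]
  rw [ENNReal.ofReal_mul (by positivity), ← lintegral_exp_Icc (by positivity) hT,
    ← lintegral_const_mul _ (by fun_prop)]
  refine lintegral_congr fun t => ?_
  rw [← ENNReal.ofReal_mul (mul_nonneg (by positivity) (Finset.prod_nonneg fun _ _ => by positivity)),
    ← ENNReal.ofReal_mul (by positivity)]
  congr 1
  -- The box half-sides cancel half of each exponent in the density, leaving the symmetric rate
  -- `S/2` for every `i`.
  have h1 : (∏ k, Real.exp (-(lam (i.succAbove k) * t))) *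
      ∏ k, (2 * Real.exp (lam (i.succAbove k) * t / 2)) =
      2 ^ n * ∏ k, Real.exp (-(lam (i.succAbove k) * t / 2)) := by
    rw [← Finset.prod_mul_distrib]
    have : (2 : ℝ) ^ n = ∏ _k : Fin n, (2 : ℝ) := by simp
    rw [this, ← Finset.prod_mul_distrib]
    refine Finset.prod_congr rfl fun k _ => ?_
    have : Real.exp (-(lam (i.succAbove k) * t / 2)) =
        Real.exp (-(lam (i.succAbove k) * t)) * Real.exp (lam (i.succAbove k) * t / 2) := by
      rw [← Real.exp_add]; congr 1; ring
    rw [this]; ring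
  have h2 : Real.exp (-((∑ j, lam j) / 2 * t)) = Real.exp (-(lam i * t / 2)) *
      ∏ k, Real.exp (-(lam (i.succAbove k) * t / 2)) := by
    rw [← Real.exp_sum, ← Real.exp_add, Fin.sum_univ_succAbove _ i, Finset.sum_neg_distrib,
      ← Finset.sum_div, ← Finset.sum_mul]
    congr 1; ring
  rw [mul_assoc, h1, h2]
  ring

theorem measurableSet_neg_le_fst {d : ℕ} (T : ℝ) :
    MeasurableSet {q : HeintzePoint d | -T ≤ q.1} :=
  measurableSet_le measurable_const measurable_fst

theorem exists_paramVolume_le {n : ℕ} {lam : Fin (n + 1) → ℝ} (hpos : ∀ i, 0 < lam i)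
    (a : FaceIndex (n + 1)) : ∃ K, 0 ≤ K ∧ ∀ T, 0 ≤ T →
      paramVolume lam (faceParam lam a) (horoFace lam a) {q | -T ≤ q.1} ≤
        ENNReal.ofReal (K * Real.exp ((∑ j, lam j) / 2 * T)) := by
  have hsum : 0 < ∑ j, lam j := Finset.sum_pos (fun j _ => hpos j) Finset.univ_nonempty
  rcases a with _ | ⟨i, s⟩
  · refine ⟨2 ^ (n + 1), by positivity, fun T hT => ?_⟩
    rw [paramVolume_apply _ (continuous_faceParam lam _).measurable _ (measurableSet_neg_le_fst T)]
    simp only [pullbackGram_faceParam_none, Matrix.det_one, Real.sqrt_one, ENNReal.ofReal_one,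
      setLIntegral_one]
    have hsub : faceParam lam none ⁻¹' ({q | -T ≤ q.1} ∩ horoFace lam none) ⊆
        Set.pi univ fun _ => Icc (-1) 1 := by
      intro u hu
      rw [mem_univ_pi]
      exact fun j => abs_le.1 ((mem_horoFace_none_iff.1 hu.2).2 j)
    refine (measure_mono hsub).trans ?_
    rw [volume_pi_pi]
    simp only [Real.volume_Icc, Finset.prod_const, Finset.card_univ, Fintype.card_fin]
    rw [← ENNReal.ofReal_pow (by norm_num)]
    refine ENNReal.ofReal_le_ofReal ?_
    -- The horizontal face has bounded volume, absorbed by an exponential that is at least 1.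
    have := Real.one_le_exp (by positivity : 0 ≤ (∑ j, lam j) / 2 * T)
    norm_num
    nlinarith [pow_pos (two_pos : (0 : ℝ) < 2) (n + 1)]
  · have hi := hpos i
    refine ⟨(1 + lam i / 2) * 2 ^ n * ((∑ j, lam j) / 2)⁻¹, by positivity, fun T hT => ?_⟩
    rw [paramVolume_apply _ (continuous_faceParam lam _).measurable _ (measurableSet_neg_le_fst T)]
    have hmeas := (continuous_faceParam lam (some (i, s))).measurable
      ((measurableSet_neg_le_fst T).inter (isClosed_horoFace lam (some (i, s))).measurableSet)
    rw [faceParam_preimage_some] at hmeas ⊢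
    refine (setLIntegral_mono' hmeas fun u hu => ENNReal.ofReal_le_ofReal ?_).trans
      ((setLIntegral_slab_exp hpos i hT (c := 1 + lam i / 2) (by positivity)).trans_le
        (ENNReal.ofReal_le_ofReal ?_))
    · rw [sqrt_det_pullbackGram_some]
      exact mul_le_mul_of_nonneg_right (sqrt_one_add_le (by positivity) hu.1.2 _ hi.le)
        (Finset.prod_nonneg fun _ _ => by positivity)
    · rw [mul_assoc _ _ (Real.exp _)]
      gcongr
      linarith

theorem le_paramVolume {n : ℕ} {lam : Fin (n + 1) → ℝ} (hpos : ∀ i, 0 < lam i)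
    (i : Fin (n + 1)) (s : Bool) {T : ℝ} (hT : 0 ≤ T) :
    ENNReal.ofReal (lam i / 2 * 2 ^ n * (((∑ j, lam j) / 2)⁻¹ *
        (Real.exp ((∑ j, lam j) / 2 * T) - 1))) ≤
      paramVolume lam (faceParam lam (some (i, s))) (horoFace lam (some (i, s)))
        ({q | -T ≤ q.1} ∩ horoFace lam (some (i, s))) := by
  have hi := hpos i
  have hS := (measurableSet_neg_le_fst T).inter (isClosed_horoFace lam (some (i, s))).measurableSet
  have hmeas := (continuous_faceParam lam (some (i, s))).measurable hS
  rw [paramVolume_apply _ (continuous_faceParam lam _).measurable _ hS, inter_assoc, inter_self]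
  rw [faceParam_preimage_some] at hmeas ⊢
  rw [← setLIntegral_slab_exp hpos i hT (c := lam i / 2) (by positivity)]
  refine setLIntegral_mono' hmeas fun u hu => ENNReal.ofReal_le_ofReal ?_
  rw [sqrt_det_pullbackGram_some]
  exact mul_le_mul_of_nonneg_right (le_sqrt_one_add _ _ _)
    (Finset.prod_nonneg fun _ _ => by positivity)

theorem exists_horosphereVolume_le {n : ℕ} {lam : Fin (n + 1) → ℝ} (hpos : ∀ i, 0 < lam i) :
    ∃ K, 0 ≤ K ∧ ∀ T, 0 ≤ T → horosphereVolume lam {q | -T ≤ q.1} ≤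
        ENNReal.ofReal (K * Real.exp ((∑ j, lam j) / 2 * T)) := by
  choose K hK0 hK using fun a => exists_paramVolume_le hpos a
  refine ⟨∑ a, K a, Finset.sum_nonneg fun a _ => hK0 a, fun T hT => ?_⟩
  rw [horosphereVolume, Measure.finsetSum_apply, Finset.sum_mul,
    ENNReal.ofReal_sum_of_nonneg fun a _ => mul_nonneg (hK0 a) (Real.exp_pos _).le]
  exact Finset.sum_le_sum fun a _ => hK a T hT

theorem paramVolume_le_horosphereVolume {d : ℕ} (lam : Fin d → ℝ) (a : FaceIndex d)
    (S : Set (HeintzePoint d)) :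
    paramVolume lam (faceParam lam a) (horoFace lam a) S ≤ horosphereVolume lam S := by
  rw [horosphereVolume, Measure.finsetSum_apply]
  exact Finset.single_le_sum
    (f := fun a => paramVolume lam (faceParam lam a) (horoFace lam a) S)
    (fun _ _ => zero_le) (Finset.mem_univ a)

/-! ### Volume growth -/

theorem exp_half_mul_log {l S W : ℝ} (hW : 0 < W) :
    Real.exp (S / 2 * (2 / l * Real.log W)) = W ^ (S / l) := by
  rw [Real.rpow_def_of_pos hW]
  congr 1
  ring

theorem hasVolumeGrowthOfOrder_approxHorosphere {n : ℕ} {lam : Fin (n + 1) → ℝ}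
    (hpos : ∀ i, 0 < lam i) (i₀ : Fin (n + 1)) (hmin : ∀ i, lam i₀ ≤ lam i) :
    HasVolumeGrowthOfOrder lam (approxHorosphere lam) (horosphereVolume lam)
      ((∑ i, lam i) / lam i₀) := by
  intro p hp
  set l := lam i₀ with hl
  have hl0 : 0 < l := hpos i₀
  set S := ∑ i, lam i with hS
  have hlS : l ≤ S := Finset.single_le_sum (fun j _ => (hpos j).le) (Finset.mem_univ i₀)
  have hS0 : 0 < S := hl0.trans_le hlS
  set k := S / l with hk
  have hk1 : 1 ≤ k := (one_le_div hl0).2 hlS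
  obtain ⟨K, hK0, hK⟩ := exists_horosphereVolume_le hpos
  obtain ⟨C, hC⟩ := exists_inducedDist_le hpos hp
  -- Chosen so that `W = r / B` gives `(1 + 2/l) W = r/2`; concatenation doubles this to `r`.
  set B : ℝ := 2 * (1 + 2 / l) with hB
  have hB0 : 0 < B := by positivity
  set c : ℝ := l / 2 * 2 ^ n * (S / 2)⁻¹ with hc
  have hc0 : 0 < c := by positivity
  -- The summands serve, in order, `1 < A`, the upper bound and the lower bound.
  set A : ℝ := 2 + K * 2 ^ k + 2 * B ^ k / c with hA
  have hA1 : 2 ≤ A := by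
    have h1 : 0 ≤ K * (2 : ℝ) ^ k := by positivity
    have h2 : 0 ≤ 2 * B ^ k / c := by positivity
    linarith
  -- The threshold forces `C < r/2`, `2 ≤ r / B` and `e^{-l p.1/2} < r`.
  refine ⟨A, by linarith, 1 + |C| * 2 + 2 * B + Real.exp (-(l * p.1 / 2)), by positivity,
    fun r hr => ?_⟩
  have hp0 := Real.exp_pos (-(l * p.1 / 2))
  have hCa := abs_nonneg C
  have hr1 : 1 < r := by linarith
  have hr0 : 0 < r := by linarith
  constructor
  · set W := r / B with hW
    have hW2 : 2 ≤ W := (le_div_iff₀ hB0).2 (by linarith)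
    have hW0 : 0 < W := by linarith
    set T := 2 / l * Real.log W with hT
    have hT0 : 0 ≤ T := mul_nonneg (by positivity) (Real.log_nonneg (by linarith))
    have hsub : {q | -T ≤ q.1} ∩ horoFace lam (some (i₀, true)) ⊆
        inducedBall lam (approxHorosphere lam) p r := by
      rintro q ⟨hqT, hq⟩
      refine ⟨horoFace_subset_approxHorosphere lam _ hq, (hC i₀ true q hq).trans_lt ?_⟩
      rw [ENNReal.ofReal_lt_ofReal_iff hr0]
      have hqW : Real.exp (-(l * q.1 / 2)) ≤ W := by
        rw [← Real.le_log_iff_exp_le hW0]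
        have h1 : l * T = 2 * Real.log W := by rw [hT]; field_simp
        have h2 : -T ≤ q.1 := hqT
        nlinarith
      have h1 : C < r / 2 := by linarith [le_abs_self C]
      have h2 : (1 + 2 / l) * (Real.exp (-(l * q.1 / 2)) - 1) < r / 2 := by
        have h3 : (1 + 2 / l) * W = r / 2 := by
          rw [hW, hB]; field_simp
        rw [← h3]
        gcongr
        linarith
      linarith [max_lt h1 h2]
    refine le_trans (ENNReal.ofReal_le_ofReal ?_) ((le_paramVolume hpos i₀ true hT0).trans
      ((measure_mono hsub).trans (paramVolume_le_horosphereVolume lam _ _)))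
    rw [← hS, hT, exp_half_mul_log hW0, ← mul_assoc, ← hl, ← hc]
    -- This turns `W ^ k - 1`, left by the integral, into at least `W ^ k / 2`.
    have hWk : 2 ≤ W ^ k := hW2.trans (Real.self_le_rpow_of_one_le (by linarith) hk1)
    have hWr : W ^ k = r ^ k / B ^ k := Real.div_rpow hr0.le hB0.le k
    have hBk : 0 < B ^ k := by positivity
    have hAi : A⁻¹ ≤ c / (2 * B ^ k) := by
      rw [← inv_div]
      refine inv_anti₀ (by positivity) ?_
      have h1 : 0 ≤ K * (2 : ℝ) ^ k := by positivity
      linarith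
    calc A⁻¹ * r ^ k ≤ c / (2 * B ^ k) * r ^ k := by gcongr
      _ = c * (W ^ k / 2) := by rw [hWr]; field_simp
      _ ≤ c * (W ^ (S / l) - 1) := by
        rw [← hk]; gcongr; linarith
  -- In the ball `e^{-l y/2} < r + e^{-l p.1/2}`, and the threshold makes the right side at most
  -- `2r`.
  · set W := 2 * r with hW
    have hW0 : 0 < W := by linarith
    set T := 2 / l * Real.log W with hT
    have hT0 : 0 ≤ T := mul_nonneg (by positivity) (Real.log_nonneg (by linarith))
    have hsub : inducedBall lam (approxHorosphere lam) p r ⊆ {q | -T ≤ q.1} := by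
      intro q hq
      have h1 := exp_lt_of_mem_inducedBall hl0.le hmin hq
      have h2 : Real.exp (-(l * q.1 / 2)) ≤ W := by linarith
      rw [← Real.le_log_iff_exp_le hW0] at h2
      have h3 : l * T = 2 * Real.log W := by rw [hT]; field_simp
      have h4 : 0 ≤ l * (q.1 + T) := by nlinarith
      have h5 := nonneg_of_mul_nonneg_right h4 hl0
      change -T ≤ q.1
      linarith
    refine (measure_mono hsub).trans ((hK T hT0).trans (ENNReal.ofReal_le_ofReal ?_))
    rw [hT, exp_half_mul_log hW0, ← hk, hW, Real.mul_rpow zero_le_two hr0.le, ← mul_assoc]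
    gcongr
    have h2 : 0 ≤ 2 * B ^ k / c := by positivity
    linarith

theorem mainTheorem3 (d : ℕ) (hd : 0 < d) (lam : Fin d → ℝ)
    (hpos : ∀ i, 0 < lam i) (hmono : Monotone lam) :
    -- the approximate horosphere is the union of its `2 d + 1` distinct faces
    approxHorosphere lam = (⋃ a : FaceIndex d, horoFace lam a) ∧
    (Set.range (horoFace lam)).ncard = 2 * d + 1 ∧
    -- each face is a smooth hypersurface with corners, glued to the others along its boundary
    (∀ a : FaceIndex d, IsSmoothHypersurfaceWithCorners (horoFace lam a)) ∧
    (∀ a : FaceIndex d, cornerBoundary (horoFace lam a) =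
      (⋃ b : {b : FaceIndex d // b ≠ a}, (horoFace lam a ∩ horoFace lam b.1))) ∧
    -- the intrinsic distance is finite
    (∀ p ∈ approxHorosphere lam, ∀ q ∈ approxHorosphere lam,
      inducedDist lam (approxHorosphere lam) p q < ⊤) ∧
    -- volume growth
    HasVolumeGrowthOfOrder lam (approxHorosphere lam) (horosphereVolume lam)
      ((∑ i, lam i) / lam ⟨0, hd⟩) := by
  obtain ⟨n, rfl⟩ := Nat.exists_eq_succ_of_ne_zero hd.ne'
  refine ⟨approxHorosphere_eq_iUnion lam, ncard_range_horoFace lam,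
    fun a p hp => ⟨_, hasCornerChart_horoFace lam a hp⟩, cornerBoundary_horoFace lam,
    fun p hp q hq => inducedDist_approxHorosphere_lt_top hpos hp hq, ?_⟩
  exact hasVolumeGrowthOfOrder_approxHorosphere hpos _ fun i => hmono (Nat.zero_le _)
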